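/- \textbf{Weak simultaneous measurement with system evolution.} Let $\Omega$ be a finite set of pointers. Pointer $j\in\Omega$ has a complex Hilbert space $\mathcal H_j$, a unit vector $\phi_j\in\mathcal H_j$ and bounded self-adjoint operators $r_j,s_j$ on $\mathcal H_j$; write $\langle T\rangle_{\phi_j}=\langle\phi_j|T|\phi_j\rangle$. The system has a complex Hilbert space $\mathcal S$, unit vectors $\psi_i,\psi_f\in\mathcal S$, a bounded self-adjoint Hamiltonian $H_{\mathcal S}$ and bounded self-adjoint operators $A_j$ $(j\in\Omega)$. Let $\tau>0$ and assume $\langle\psi_f|e^{-i\tau H_{\mathcal S}}|\psi_i\rangle\neq0$. On $\mathcal P\otimes\mathcal S$, where $\mathcal P=\bigotimes_{j\in\Omega}\mathcal H_j$, put for $\gamma\in\mathbb R^\Omega$ $$H=\hat 1_{\mathcal P}\otimes H_{\mathcal S}+\sum_{k\in\Omega}\gamma_k\,\frac{s_k}{\tau}\otimes A_k,\qquad P_i=\Big(\bigotimes_{j}|\phi_j\rangle\langle\phi_j|\Big)\otimes|\psi_i\rangle\langle\psi_i|,\qquad P_f=\hat 1_{\mathcal P}\otimes|\psi_f\rangle\langle\psi_f|,$$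 and let $$\sigma=\sigma(\gamma)=\frac{\operatorname{tr}_{\mathcal S}\big(P_fe^{-i\tau H}P_ie^{i\tau H}\big)}{\operatorname{tr}\big(P_fe^{-i\tau H}P_ie^{i\tau H}\big)}$$ be the state of the pointers after postselection of the system in $\psi_f$. For $a\subseteq\Omega$ let $\langle\prod_{j\in a}r_j\rangle_\sigma=\operatorname{tr}\big((\prod_{j\in a}r_j)\,\sigma\big)$. For a function $f$ from the subsets of $\Omega$ to $\mathbb C$ with $f(\emptyset)\neq0$ let $\log^*f(\emptyset)=\log f(\emptyset)$ and, for $a\ne\emptyset$, $$\log^*f(a)=\sum_{p}(-1)^{|p|-1}(|p|-1)!\,\frac{\prod_{c\in p}f(c)}{f(\emptyset)^{|p|}},$$ the sum being over all partitions $p$ of $a$. For $a=\{a_1,\dots,a_k\}$ let $$\mathcal D(a)=\frac1{\tau^k}\sum_{\pi}\int_{\tau_1,\dots,\tau_{k+1}\ge0}\frac{\langle\psi_f|e^{-iH_{\mathcal S}\tau_{k+1}}A_{a_{\pi(k)}}e^{-iH_{\mathcal S}\tau_k}\cdots A_{a_{\pi(1)}}e^{-iH_{\mathcal S}\tau_1}|\psi_i\rangle}{\langle\psi_f|e^{-i\tau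 H_{\mathcal S}}|\psi_i\rangle}\,\delta\Big(\tau-\sum_{j=1}^{k+1}\tau_j\Big)\,d\tau_1\cdots d\tau_{k+1},$$ where $\pi$ runs over all permutations of $\{1,\dots,k\}$, and let $$\xi=\xi(a)=2(-i)^{|a|}\prod_{j\in a}\big(\langle r_js_j\rangle_{\phi_j}-\langle r_j\rangle_{\phi_j}\langle s_j\rangle_{\phi_j}\big).$$ Then for every $a\subseteq\Omega$ the pointer cumulant $\gamma\mapsto\log^*\langle\prod_{j\in a}r_j\rangle_{\sigma(\gamma)}$ is real analytic near $\gamma=0$, and to the lowest joint order in $\gamma$ it equals $(\prod_{j\in a}\gamma_j)\operatorname{Re}\{\xi\log^*\mathcal D(a)\}$ (up to the constant $\langle r_j\rangle_{\phi_j}$ if $a=\{j\}$): as $\gamma\to0$, $$\log^*\Big\langle\prod_{j\in a}r_j\Big\rangle_\sigma=\Big(\prod_{j\in a}\gamma_j\Big)\operatorname{Re}\{\xi\log^*\mathcal D(a)\}+O\big(\|\gamma\|^{|a|+1}\big)\qquad\text{if }|a|\neq1,$$ $$\langle r_j\rangle_\sigma=\langle r_j\rangle_{\phi_j}+\gamma_j\operatorname{Re}\{\xi\log^*\mathcal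 D(\{j\})\}+O\big(\|\gamma\|^{2}\big)\qquad\text{if }a=\{j\}.$$ -/

import Mathlib

noncomputable section

namespace WeakMeasurement

open scoped TensorProduct InnerProductSpace ComplexOrder
open UniformSpace

universe u v w

/-! ### The Hilbert space tensor product of a finite family of Hilbert spaces

`PreTensor H` is the algebraic tensor product of the `H j` with the pre-inner product determined by
`⟪⊗ x j, ⊗ y j⟫ = ∏ j, ⟪x j, y j⟫`; its completion is the Hilbert space tensor product. -/

section PiTensor

variable {Ω : Type u} [Fintype Ω] (H : Ω → Type v) [∀ j, NormedAddCommGroup (H j)]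
  [∀ j, InnerProductSpace ℂ (H j)]

/-- The algebraic tensor product of the spaces `H j` (a copy of Mathlib's type, because the latter
carries the projective seminorm and not the Hilbert space one). -/
def PreTensor : Type (max u v) := PiTensorProduct ℂ H

instance : AddCommGroup (PreTensor H) := inferInstanceAs (AddCommGroup (PiTensorProduct ℂ H))

instance : Module ℂ (PreTensor H) := inferInstanceAs (Module ℂ (PiTensorProduct ℂ H))

variable {H}

/-- The elementary tensor `⊗ x j`. -/
def PreTensor.tprod (x : ∀ j, H j) : PreTensor H := PiTensorProduct.tprod ℂ x

theorem PreTensor.exists_rep (z : PreTensor H) :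
    ∃ c : (∀ j, H j) →₀ ℂ, z = ∑ x ∈ c.support, c x • PreTensor.tprod x := by
  have hz : ∀ z : PiTensorProduct ℂ H,
      z ∈ Submodule.span ℂ (Set.range (PiTensorProduct.tprod ℂ (s := H))) := by
    rw [PiTensorProduct.span_tprod_eq_top]; exact fun _ => Submodule.mem_top
  obtain ⟨c, hc⟩ := (Finsupp.mem_span_range_iff_exists_finsupp).1 (hz z)
  exact ⟨c, hc.symm⟩

/-- The linear functional `⊗ y j ↦ ∏ j, ⟪x j, y j⟫`. -/
def PreTensor.bra (x : ∀ j, H j) : PreTensor H →ₗ[ℂ] ℂ :=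
  PiTensorProduct.lift ((MultilinearMap.mkPiAlgebra ℂ Ω ℂ).compLinearMap
    fun j => (innerSL ℂ (x j)).toLinearMap)

theorem PreTensor.bra_tprod (x y : ∀ j, H j) :
    PreTensor.bra x (PreTensor.tprod y) = ∏ j, ⟪x j, y j⟫_ℂ := by
  simp only [PreTensor.bra, PreTensor.tprod]
  erw [PiTensorProduct.lift.tprod]
  simp

theorem PreTensor.lin_ext {φ ψ : PreTensor H →ₗ[ℂ] ℂ}
    (h : ∀ y : ∀ j, H j, φ (PreTensor.tprod y) = ψ (PreTensor.tprod y)) : φ = ψ := by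
  refine LinearMap.ext fun z => ?_
  obtain ⟨c, rfl⟩ := PreTensor.exists_rep z
  simp [map_sum, h]

theorem PreTensor.bra_update_add [DecidableEq Ω] (x : ∀ j, H j) (i : Ω) (m m' : H i) :
    PreTensor.bra (Function.update x i (m + m')) =
      PreTensor.bra (Function.update x i m) + PreTensor.bra (Function.update x i m') := by
  refine PreTensor.lin_ext fun y => ?_
  have key : ∀ n : H i, ∏ j, ⟪Function.update x i n j, y j⟫_ℂ =
      ⟪n, y i⟫_ℂ * ∏ j ∈ Finset.univ.erase i, ⟪x j, y j⟫_ℂ := by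
    intro n
    rw [← Finset.mul_prod_erase _ _ (Finset.mem_univ i), Function.update_self]
    congr 1
    refine Finset.prod_congr rfl fun j hj => ?_
    rw [Function.update_of_ne (Finset.ne_of_mem_erase hj)]
  simp only [LinearMap.add_apply, PreTensor.bra_tprod, key, inner_add_left, add_mul]

theorem PreTensor.bra_update_smul [DecidableEq Ω] (x : ∀ j, H j) (i : Ω) (c : ℂ) (m : H i) :
    PreTensor.bra (Function.update x i (c • m)) =
      (starRingEnd ℂ c) • PreTensor.bra (Function.update x i m) := by
  refine PreTensor.lin_ext fun y => ?_
  have key : ∀ n : H i, ∏ j, ⟪Function.update x i n j, y j⟫_ℂ =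
      ⟪n, y i⟫_ℂ * ∏ j ∈ Finset.univ.erase i, ⟪x j, y j⟫_ℂ := by
    intro n
    rw [← Finset.mul_prod_erase _ _ (Finset.mem_univ i), Function.update_self]
    congr 1
    refine Finset.prod_congr rfl fun j hj => ?_
    rw [Function.update_of_ne (Finset.ne_of_mem_erase hj)]
  simp only [LinearMap.smul_apply, PreTensor.bra_tprod, key, inner_smul_left, smul_eq_mul,
    mul_assoc]

/-- The form `(y, x) ↦ ⟪x, y⟫`, linear in `y` and conjugate linear in `x`. -/
def PreTensor.form : PreTensor H →ₗ[ℂ] (PreTensor H →ₛₗ[starRingEnd ℂ] ℂ) :=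
  PiTensorProduct.lift
    { toFun := fun y =>
        { toFun := fun x => starRingEnd ℂ (PreTensor.bra y x)
          map_add' := fun x x' => by simp
          map_smul' := fun c x => by simp }
      map_update_add' := fun y i m m' => by
        refine LinearMap.ext fun x => ?_
        simp [PreTensor.bra_update_add]
      map_update_smul' := fun y i c m => by
        refine LinearMap.ext fun x => ?_
        simp [PreTensor.bra_update_smul] }

theorem PreTensor.form_tprod (y : ∀ j, H j) (x : PreTensor H) :
    PreTensor.form (PreTensor.tprod y) x = starRingEnd ℂ (PreTensor.bra y x) := by
  simp only [PreTensor.form, PreTensor.tprod]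
  erw [PiTensorProduct.lift.tprod]
  rfl

theorem PreTensor.form_tprod_tprod (x y : ∀ j, H j) :
    PreTensor.form (PreTensor.tprod y) (PreTensor.tprod x) = ∏ j, ⟪x j, y j⟫_ℂ := by
  rw [PreTensor.form_tprod, PreTensor.bra_tprod, map_prod]
  simp

theorem PreTensor.form_sum_sum (c d : (∀ j, H j) →₀ ℂ) (f g : (∀ j, H j) → (∀ j, H j)) :
    PreTensor.form (∑ y ∈ d.support, d y • PreTensor.tprod (g y))
        (∑ x ∈ c.support, c x • PreTensor.tprod (f x)) =
      ∑ x ∈ c.support, ∑ y ∈ d.support,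
        starRingEnd ℂ (c x) * (∏ j, ⟪f x j, g y j⟫_ℂ) * d y := by
  simp only [map_sum, map_smul, LinearMap.sum_apply, LinearMap.smul_apply, LinearMap.map_smulₛₗ,
    PreTensor.form_tprod_tprod, smul_eq_mul]
  refine Finset.sum_congr rfl fun x _ => ?_
  rw [Finset.mul_sum]
  refine Finset.sum_congr rfl fun y _ => ?_
  ring

theorem posSemidef_gram_family {n E : Type*} [NormedAddCommGroup E] [InnerProductSpace ℂ E]
    (f : n → E) : (Matrix.gram ℂ f).PosSemidef := by
  refine ⟨Matrix.isHermitian_gram ℂ f, fun c => ?_⟩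
  have h : (c.sum fun i xi => c.sum fun j xj => star xi * Matrix.gram ℂ f i j * xj) =
      ⟪∑ i ∈ c.support, c i • f i, ∑ i ∈ c.support, c i • f i⟫_ℂ := by
    simp only [Finsupp.sum, Matrix.gram_apply, sum_inner]
    refine Finset.sum_congr rfl fun x _ => ?_
    rw [inner_sum]
    refine Finset.sum_congr rfl fun y _ => ?_
    rw [inner_smul_left, inner_smul_right, RCLike.star_def]
    ring
  rw [h]
  exact RCLike.nonneg_iff.2 ⟨inner_self_nonneg, inner_self_im _⟩

/-- Monotonicity of entrywise products of positive semidefinite matrices. -/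
theorem posSemidef_prod_sub_prod {n ι : Type*} (s : Finset ι) (A B : ι → Matrix n n ℂ)
    (hB : ∀ j, (B j).PosSemidef) (hAB : ∀ j, (A j - B j).PosSemidef) :
    (Matrix.of fun x y => ∏ j ∈ s, B j x y).PosSemidef ∧
    ((Matrix.of fun x y => ∏ j ∈ s, A j x y) -
      Matrix.of fun x y => ∏ j ∈ s, B j x y).PosSemidef := by
  classical
  induction s using Finset.induction_on with
  | empty =>
    refine ⟨?_, ?_⟩
    · have h : (Matrix.of fun _ _ => ∏ j ∈ (∅ : Finset ι), (1 : ℂ) : Matrix n n ℂ) =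
          Matrix.gram ℂ (fun _ : n => (1 : ℂ)) := by
        ext; simp [Matrix.gram_apply]
      simpa using h ▸ posSemidef_gram_family (fun _ : n => (1 : ℂ))
    · simpa using (Matrix.PosSemidef.zero : (0 : Matrix n n ℂ).PosSemidef)
  | insert i s hi ih =>
    obtain ⟨h1, h2⟩ := ih
    have hA : (A i).PosSemidef := by simpa using (hAB i).add (hB i)
    have e1 : (Matrix.of fun x y => ∏ j ∈ insert i s, B j x y) =
        Matrix.hadamard (B i) (Matrix.of fun x y => ∏ j ∈ s, B j x y) := by
      ext x y; simp [Finset.prod_insert hi]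
    have e2 : ((Matrix.of fun x y => ∏ j ∈ insert i s, A j x y) -
        Matrix.of fun x y => ∏ j ∈ insert i s, B j x y) =
        Matrix.hadamard (A i) ((Matrix.of fun x y => ∏ j ∈ s, A j x y) -
          Matrix.of fun x y => ∏ j ∈ s, B j x y) +
        Matrix.hadamard (A i - B i) (Matrix.of fun x y => ∏ j ∈ s, B j x y) := by
      ext x y; simp [Finset.prod_insert hi]; ring
    exact ⟨e1 ▸ (hB i).hadamard h1, e2 ▸ (hA.hadamard h2).add ((hAB i).hadamard h1)⟩

theorem PreTensor.form_symm (x y : PreTensor H) :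
    starRingEnd ℂ (PreTensor.form x y) = PreTensor.form y x := by
  obtain ⟨c, rfl⟩ := PreTensor.exists_rep x
  obtain ⟨d, rfl⟩ := PreTensor.exists_rep y
  have h1 := PreTensor.form_sum_sum d c id id
  have h2 := PreTensor.form_sum_sum c d id id
  simp only [id] at h1 h2
  rw [h1, h2, Finset.sum_comm]
  simp only [map_sum, map_mul, map_prod, inner_conj_symm, Complex.conj_conj]
  refine Finset.sum_congr rfl fun x _ => Finset.sum_congr rfl fun y _ => ?_
  ring

theorem PreTensor.form_self_nonneg (x : PreTensor H) : 0 ≤ PreTensor.form x x := by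
  obtain ⟨c, rfl⟩ := PreTensor.exists_rep x
  have h0 := PreTensor.form_sum_sum c c id id
  simp only [id] at h0
  rw [h0]
  have h := (posSemidef_prod_sub_prod (n := ∀ j, H j) Finset.univ
    (fun j => Matrix.gram ℂ fun x : ∀ j, H j => x j)
    (fun j => Matrix.gram ℂ fun x : ∀ j, H j => x j) (fun j => posSemidef_gram_family _)
    (fun j => by simpa using Matrix.PosSemidef.zero)).1.2 c
  simpa [Finsupp.sum, Matrix.gram_apply] using h

/-- The pre-inner product on the algebraic tensor product. -/
@[reducible] def PreTensor.core : PreInnerProductSpace.Core ℂ (PreTensor H) where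
  inner x y := PreTensor.form y x
  conj_inner_symm x y := PreTensor.form_symm x y
  re_inner_nonneg x := (Complex.nonneg_iff.1 (PreTensor.form_self_nonneg x)).1
  add_left x y z := by simp
  smul_left x y c := by simp

instance : SeminormedAddCommGroup (PreTensor H) :=
  @InnerProductSpace.Core.toSeminormedAddCommGroup ℂ (PreTensor H) _ _ _ PreTensor.core

instance : InnerProductSpace ℂ (PreTensor H) := InnerProductSpace.ofCore PreTensor.core

theorem PreTensor.inner_eq (x y : PreTensor H) : ⟪x, y⟫_ℂ = PreTensor.form y x := rfl

theorem PreTensor.inner_tprod (x y : ∀ j, H j) :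
    ⟪PreTensor.tprod x, PreTensor.tprod y⟫_ℂ = ∏ j, ⟪x j, y j⟫_ℂ :=
  PreTensor.form_tprod_tprod x y

/-- The linear map `⊗ T j` on the algebraic tensor product. -/
def PreTensor.mapLin (T : ∀ j, H j →L[ℂ] H j) : PreTensor H →ₗ[ℂ] PreTensor H :=
  PiTensorProduct.map (fun j => (T j).toLinearMap)

theorem PreTensor.mapLin_tprod (T : ∀ j, H j →L[ℂ] H j) (x : ∀ j, H j) :
    PreTensor.mapLin T (PreTensor.tprod x) = PreTensor.tprod (fun j => T j (x j)) :=
  PiTensorProduct.map_tprod _ _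

theorem PreTensor.norm_mapLin_le (T : ∀ j, H j →L[ℂ] H j) (x : PreTensor H) :
    ‖PreTensor.mapLin T x‖ ≤ (∏ j, ‖T j‖) * ‖x‖ := by
  refine le_of_sq_le_sq ?_ (by positivity)
  rw [mul_pow, @norm_sq_eq_re_inner ℂ, @norm_sq_eq_re_inner ℂ]
  obtain ⟨c, rfl⟩ := PreTensor.exists_rep x
  have h0 := PreTensor.form_sum_sum c c id id
  simp only [id] at h0
  have h1 : PreTensor.mapLin T (∑ x ∈ c.support, c x • PreTensor.tprod x) =
      ∑ x ∈ c.support, c x • PreTensor.tprod (fun j => T j (x j)) := by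
    simp only [map_sum, map_smul, PreTensor.mapLin_tprod]
  rw [h1, PreTensor.inner_eq, PreTensor.inner_eq, h0,
    PreTensor.form_sum_sum c c (fun x j => T j (x j)) (fun x j => T j (x j))]
  have h := (posSemidef_prod_sub_prod (n := ∀ j, H j) Finset.univ
    (fun j => ‖T j‖ ^ 2 • Matrix.gram ℂ fun x : ∀ j, H j => x j)
    (fun j => Matrix.gram ℂ (T j ∘ fun x : ∀ j, H j => x j)) (fun j => posSemidef_gram_family _)
    (fun j => Matrix.posSemidef_opNorm_smul_gram_sub_gram _ _)).2.2 c
  have h' := (Complex.nonneg_iff.1 h).1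
  have e : (c.sum fun x a => c.sum fun y b => star a * (((Matrix.of fun x y => ∏ j,
      (‖T j‖ ^ 2 • Matrix.gram ℂ fun x : ∀ j, H j => x j) x y) - Matrix.of fun x y => ∏ j,
      (Matrix.gram ℂ (T j ∘ fun x : ∀ j, H j => x j)) x y : Matrix _ _ ℂ) x y) * b) =
      (((∏ j, ‖T j‖) ^ 2 : ℝ) : ℂ) * (∑ x ∈ c.support, ∑ y ∈ c.support,
        starRingEnd ℂ (c x) * (∏ j, ⟪x j, y j⟫_ℂ) * c y) -
      ∑ x ∈ c.support, ∑ y ∈ c.support,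
        starRingEnd ℂ (c x) * (∏ j, ⟪T j (x j), T j (y j)⟫_ℂ) * c y := by
    simp only [Finsupp.sum, Finset.mul_sum, ← Finset.sum_sub_distrib]
    refine Finset.sum_congr rfl fun x _ => Finset.sum_congr rfl fun y _ => ?_
    simp [Matrix.gram_apply, Finset.prod_mul_distrib, Finset.prod_pow]
    ring
  rw [e, Complex.sub_re, Complex.re_ofReal_mul] at h'
  simpa using h'

/-- The operator `⊗ T j` on the algebraic tensor product. -/
def PreTensor.mapL (T : ∀ j, H j →L[ℂ] H j) : PreTensor H →L[ℂ] PreTensor H :=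
  (PreTensor.mapLin T).mkContinuous (∏ j, ‖T j‖) (PreTensor.norm_mapLin_le T)

variable (H) in
/-- The Hilbert space tensor product `⨂ j, H j`. -/
def HilbertTensor : Type (max u v) := Completion (PreTensor H)

instance : NormedAddCommGroup (HilbertTensor H) :=
  inferInstanceAs (NormedAddCommGroup (Completion (PreTensor H)))

instance : InnerProductSpace ℂ (HilbertTensor H) :=
  inferInstanceAs (InnerProductSpace ℂ (Completion (PreTensor H)))

instance : CompleteSpace (HilbertTensor H) :=
  inferInstanceAs (CompleteSpace (Completion (PreTensor H)))

/-- The product vector `⊗ x j`. -/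
def productVector (x : ∀ j, H j) : HilbertTensor H :=
  ((PreTensor.tprod x : PreTensor H) : Completion (PreTensor H))

/-- The bounded operator `⊗ T j`. -/
def tensorOp (T : ∀ j, H j →L[ℂ] H j) : HilbertTensor H →L[ℂ] HilbertTensor H :=
  (PreTensor.mapL T).completion

/-- The operator on `⨂ j, H j` that acts as `T` on factor `k` and as the identity elsewhere. -/
def siteOp [DecidableEq Ω] (k : Ω) (T : H k →L[ℂ] H k) : HilbertTensor H →L[ℂ] HilbertTensor H :=
  tensorOp (Function.update (fun j => (1 : H j →L[ℂ] H j)) k T)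

theorem inner_productVector (x y : ∀ j, H j) :
    ⟪productVector x, productVector y⟫_ℂ = ∏ j, ⟪x j, y j⟫_ℂ :=
  (Completion.inner_coe _ _).trans (PreTensor.inner_tprod x y)

theorem tensorOp_productVector (T : ∀ j, H j →L[ℂ] H j) (x : ∀ j, H j) :
    tensorOp T (productVector x) = productVector (fun j => T j (x j)) := by
  refine (ContinuousLinearMap.completion_apply_coe (PreTensor.mapL T) _).trans ?_
  exact congrArg _ (PreTensor.mapLin_tprod T x)

end PiTensor

/-! ### Two factors, traces and partial traces -/

section Bipartite

variable (P : Type v) (S : Type w) [NormedAddCommGroup P] [InnerProductSpace ℂ P]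
  [NormedAddCommGroup S] [InnerProductSpace ℂ S]

/-- The Hilbert space tensor product `P ⊗ S` of two spaces. -/
def Bipartite : Type (max v w) := Completion (P ⊗[ℂ] S)

instance : NormedAddCommGroup (Bipartite P S) :=
  inferInstanceAs (NormedAddCommGroup (Completion (P ⊗[ℂ] S)))

instance : InnerProductSpace ℂ (Bipartite P S) :=
  inferInstanceAs (InnerProductSpace ℂ (Completion (P ⊗[ℂ] S)))

instance : CompleteSpace (Bipartite P S) :=
  inferInstanceAs (CompleteSpace (Completion (P ⊗[ℂ] S)))

variable {P S}

/-- The bounded operator `B ⊗ A` on `P ⊗ S`. -/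
def opTensor (B : P →L[ℂ] P) (A : S →L[ℂ] S) : Bipartite P S →L[ℂ] Bipartite P S :=
  (TensorProduct.mapL B A).completion

/-- The bounded operator `x ↦ x ⊗ e` from `P` to `P ⊗ S`. -/
def tensorRight (e : S) : P →L[ℂ] Bipartite P S :=
  Completion.toComplL ∘L (TensorProduct.mkL ℂ P S).flip e

/-- The operator `|x⟩⟨x|`, the orthogonal projector onto the line of `x` when `‖x‖ = 1`. -/
def ketbra (x : S) : S →L[ℂ] S := InnerProductSpace.rankOne ℂ x x

variable (S) in
/-- The index set of a chosen Hilbert basis of `S`. -/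
def basisSet [CompleteSpace S] : Set S := (exists_hilbertBasis ℂ S).choose

variable (S) in
/-- A chosen Hilbert basis of `S`. -/
def chosenBasis [CompleteSpace S] : HilbertBasis (basisSet S) ℂ S :=
  (exists_hilbertBasis ℂ S).choose_spec.choose

/-- The trace `∑ i, ⟨e i| T |e i⟩` over an orthonormal basis; on trace class operators it does not
depend on the basis. -/
def trace [CompleteSpace S] (T : S →L[ℂ] S) : ℂ :=
  ∑' i, ⟪chosenBasis S i, T (chosenBasis S i)⟫_ℂ

/-- The partial trace over `S`: `∑ i, (1 ⊗ ⟨e i|) T (1 ⊗ |e i⟩)` over an orthonormal basis of `S`; the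
series converges in norm when `T` is of trace class. -/
def partialTrace [CompleteSpace P] [CompleteSpace S] (T : Bipartite P S →L[ℂ] Bipartite P S) :
    P →L[ℂ] P :=
  ∑' i, ContinuousLinearMap.adjoint (tensorRight (P := P) (chosenBasis S i)) ∘L T ∘L
    tensorRight (chosenBasis S i)

end Bipartite

/-! ### Cumulants -/

/-- The cumulant `log* f` of a function `f` on finite subsets: `log (f ∅)` at `∅`, and
`∑ p, (-1)^(|p|-1) (|p|-1)! ∏ c ∈ p, f c / (f ∅)^|p|`, summed over all partitions `p` of `a`, at
`a ≠ ∅`. -/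
def logStar {Ω : Type u} [DecidableEq Ω] (f : Finset Ω → ℂ) (a : Finset Ω) : ℂ :=
  if a = ∅ then Complex.log (f ∅)
  else ∑ p : Finpartition a,
    (-1) ^ (p.parts.card - 1) * ((p.parts.card - 1).factorial : ℂ) *
      ((∏ c ∈ p.parts, f c) / f ∅ ^ p.parts.card)

/-! ### The measurement -/

/-- The data of a simultaneous measurement of the system `S` by pointers `j : Ω` with state spaces
`H j`. -/
structure Setup (Ω : Type u) (H : Ω → Type v) (S : Type w) [∀ j, NormedAddCommGroup (H j)]
    [∀ j, InnerProductSpace ℂ (H j)] [NormedAddCommGroup S] [InnerProductSpace ℂ S] where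
  /-- the duration of the coupling -/
  τ : ℝ
  /-- the Hamiltonian of the system -/
  HS : S →L[ℂ] S
  /-- the system operator to which pointer `j` is coupled -/
  A : Ω → S →L[ℂ] S
  /-- the operator of pointer `j` through which it is coupled -/
  s : ∀ j, H j →L[ℂ] H j
  /-- the observable measured on pointer `j` -/
  r : ∀ j, H j →L[ℂ] H j
  /-- the initial state of pointer `j` -/
  φ : ∀ j, H j
  /-- the initial state of the system -/
  ψi : S
  /-- the postselected final state of the system -/
  ψf : S

namespace Setup

variable {Ω : Type u} {H : Ω → Type v} {S : Type w} [∀ j, NormedAddCommGroup (H j)]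
  [∀ j, InnerProductSpace ℂ (H j)] [NormedAddCommGroup S] [InnerProductSpace ℂ S]
  (W : Setup Ω H S)

/-- The evolution `exp (-i t HS)` of the system alone. -/
def sysEvol (t : ℝ) : S →L[ℂ] S := NormedSpace.exp ((-Complex.I * (t : ℂ)) • W.HS)

section Pointers

variable [Fintype Ω] [DecidableEq Ω]

/-- The total Hamiltonian `1 ⊗ HS + ∑ k, γ k (s k / τ) ⊗ A k`. -/
def hamiltonian (γ : Ω → ℝ) :
    Bipartite (HilbertTensor H) S →L[ℂ] Bipartite (HilbertTensor H) S :=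
  opTensor 1 W.HS + ∑ k, (γ k : ℂ) • opTensor ((W.τ : ℂ)⁻¹ • siteOp k (W.s k)) (W.A k)

/-- The projector onto the initial state. -/
def projInit : Bipartite (HilbertTensor H) S →L[ℂ] Bipartite (HilbertTensor H) S :=
  opTensor (tensorOp fun j => ketbra (W.φ j)) (ketbra W.ψi)

/-- The projector of the postselection. -/
def projFinal : Bipartite (HilbertTensor H) S →L[ℂ] Bipartite (HilbertTensor H) S :=
  opTensor 1 (ketbra W.ψf)

/-- The operator `P_f e^{-iτH} P_i e^{iτH}`. -/
def unnormalized (γ : Ω → ℝ) :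
    Bipartite (HilbertTensor H) S →L[ℂ] Bipartite (HilbertTensor H) S :=
  W.projFinal * NormedSpace.exp ((-Complex.I * (W.τ : ℂ)) • W.hamiltonian γ) * W.projInit *
    NormedSpace.exp ((Complex.I * (W.τ : ℂ)) • W.hamiltonian γ)

variable [CompleteSpace S]

/-- The state `σ` of the pointers after the postselection. -/
def pointerState (γ : Ω → ℝ) : HilbertTensor H →L[ℂ] HilbertTensor H :=
  (trace (W.unnormalized γ))⁻¹ • partialTrace (W.unnormalized γ)

/-- The moment `⟨∏ j ∈ a, r j⟩_σ`. -/
def pointerMoment (γ : Ω → ℝ) (a : Finset Ω) : ℂ :=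
  trace (tensorOp (fun j => if j ∈ a then W.r j else 1) * W.pointerState γ)

/-- The pointer cumulant `log* ⟨∏ j ∈ a, r j⟩_σ`, as a function of the coupling strengths. -/
def pointerCumulant (a : Finset Ω) (γ : Ω → ℝ) : ℂ := logStar (W.pointerMoment γ) a

end Pointers

/-- `e^{-i HS t_{k+1}} B_k e^{-i HS t_k} ⋯ B_1 e^{-i HS t_1}`, with indices starting at `0`. -/
def sequentialOp : (k : ℕ) → (Fin k → S →L[ℂ] S) → (Fin (k + 1) → ℝ) → S →L[ℂ] S
  | 0, _, t => W.sysEvol (t 0)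
  | k + 1, B, t => W.sysEvol (t (Fin.last (k + 1))) * B (Fin.last k) *
      sequentialOp k (fun i => B i.castSucc) (fun i => t i.castSucc)

/-- The sequential weak value `(B_k, …, B_1)_w[t_{k+1}, …, t_1]`. -/
def seqWeakValue (k : ℕ) (B : Fin k → S →L[ℂ] S) (t : Fin (k + 1) → ℝ) : ℂ :=
  ⟪W.ψf, W.sequentialOp k B t W.ψi⟫_ℂ / ⟪W.ψf, W.sysEvol W.τ W.ψi⟫_ℂ

/-- The average of the sequential weak values over all orderings of the `A j`, `j ∈ a`, and all
splittings `τ = t_1 + ⋯ + t_{k+1}` into intervals of lengths `t_i ≥ 0`; the constraint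
`δ(τ - ∑ t_i)` is used to eliminate the last length. -/
def avgWeakValue [DecidableEq Ω] (a : Finset Ω) : ℂ :=
  ((W.τ : ℂ) ^ a.card)⁻¹ * ∑ e : Fin a.card ≃ a,
    ∫ t in {t : Fin a.card → ℝ | (∀ i, 0 ≤ t i) ∧ ∑ i, t i ≤ W.τ},
      W.seqWeakValue a.card (fun i => W.A (e i)) (Fin.snoc (α := fun _ => ℝ) t (W.τ - ∑ i, t i))

/-- The expectation `⟨φ j| T |φ j⟩`. -/
def pointerMean (j : Ω) (T : H j →L[ℂ] H j) : ℂ := ⟪W.φ j, T (W.φ j)⟫_ℂ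

/-- The constant `ξ = 2 (-i)^|a| ∏ j ∈ a, (⟨r j s j⟩ - ⟨r j⟩ ⟨s j⟩)`. -/
def xi (a : Finset Ω) : ℂ :=
  2 * (-Complex.I) ^ a.card *
    ∏ j ∈ a, (W.pointerMean j (W.r j * W.s j) - W.pointerMean j (W.r j) * W.pointerMean j (W.s j))

end Setup

end WeakMeasurement

end

/-!
The state `σ(γ)` is the pure state of the vector `χ(γ) = ⟨ψf| e^{-iτH} |φ ⊗ ψi⟩`, so the pointer
moments are `⟨χ| ∏ r j |χ⟩ / ⟨χ|χ⟩`, and the normalization does not affect cumulants of nonempty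
sets. On the algebra of set functions under subset convolution, cumulants turn products into sums.
Replacing `r j` by `r j - ⟨r j⟩` divides the moments by the set function `∏ ⟨r j⟩`, whose cumulants
vanish except on singletons, so it is enough to treat the centered observables.

Expand `χ` in the Dyson series in the couplings `γ`. In the centered moment over `c` every term
in which some `j ∈ c` is not coupled vanishes, as `⟨φ j| (r j - ⟨r j⟩) |φ j⟩ = 0`. The surviving
terms of order at most `|c|` contain each `γ j`, `j ∈ c`, exactly once, either in the ket or in the
bra. Hence the lowest order is the subset convolution of `L` and its conjugate, where
`L b = ⟨ψf| e^{-iτHS} |ψi⟩ * ∏ j ∈ b, (-i cov j) * D b`, and its cumulant is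
`2 Re (log* L) = Re (ξ log* D)`.
-/

noncomputable section

namespace WeakMeasurement

open scoped TensorProduct InnerProductSpace ComplexOrder
open UniformSpace

universe u v w

/-! ### Cumulants and subset convolution -/

section SubsetConvolution

variable {Ω R : Type*} [DecidableEq Ω]

section Semiring

variable [CommSemiring R]

/-- The subset convolution of two set functions: the product of their squarefree generating
functions `∑ a, f a * x ^ a`. Moments of sums of independent contributions combine in this way. -/
def subsetConv (f g : Finset Ω → R) (a : Finset Ω) : R := ∑ b ∈ a.powerset, f b * g (a \ b)

/-- The operator `x j ∂/∂x j` on squarefree generating functions; it is a derivation of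
`subsetConv` and serves to characterise cumulants. -/
def siteDeriv (j : Ω) (f : Finset Ω → R) (a : Finset Ω) : R := if j ∈ a then f a else 0

/-- `κ` satisfies the equations `x j ∂f/∂x j = (x j ∂κ/∂x j) * f` of a logarithm of `f` in the
algebra of set functions under `subsetConv`; they leave `κ ∅` free. -/
def IsCumulant (κ f : Finset Ω → R) : Prop := ∀ j, siteDeriv j f = subsetConv (siteDeriv j κ) f

theorem subsetConv_empty (f g : Finset Ω → R) : subsetConv f g ∅ = f ∅ * g ∅ := by
  simp [subsetConv]

theorem subsetConv_comm (f g : Finset Ω → R) : subsetConv f g = subsetConv g f := by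
  ext a
  refine Finset.sum_nbij' (a \ ·) (a \ ·) (by simp) (by simp) (by simp) (by simp) fun b hb => ?_
  rw [Finset.sdiff_sdiff_eq_self (Finset.mem_powerset.1 hb), mul_comm]

theorem subsetConv_assoc (f g h : Finset Ω → R) :
    subsetConv (subsetConv f g) h = subsetConv f (subsetConv g h) := by
  ext a
  simp only [subsetConv, Finset.sum_mul, Finset.mul_sum, Finset.sum_sigma']
  refine Finset.sum_nbij' (fun x => ⟨x.2, x.1 \ x.2⟩) (fun x => ⟨x.1 ∪ x.2, x.1⟩) ?_ ?_ ?_ ?_ ?_ <;>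
    rintro ⟨b, c⟩ hx <;> simp only [Finset.mem_sigma, Finset.mem_powerset] at hx ⊢
  · exact ⟨hx.2.trans hx.1, Finset.sdiff_subset_sdiff hx.1 subset_rfl⟩
  · exact ⟨Finset.union_subset hx.1 (hx.2.trans Finset.sdiff_subset), Finset.subset_union_left⟩
  · simp [Finset.union_sdiff_of_subset hx.2]
  · have hd : Disjoint c b := Finset.disjoint_of_subset_left hx.2 Finset.sdiff_disjoint
    simp [Finset.union_sdiff_left, Finset.sdiff_eq_self_of_disjoint hd]
  · rw [sdiff_sdiff_left, Finset.sup_eq_union, Finset.union_sdiff_of_subset hx.2, mul_assoc]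

theorem add_subsetConv (f g h : Finset Ω → R) :
    subsetConv (f + g) h = subsetConv f h + subsetConv g h := by
  ext a
  simp [subsetConv, add_mul, Finset.sum_add_distrib]

theorem siteDeriv_add (j : Ω) (f g : Finset Ω → R) :
    siteDeriv j (f + g) = siteDeriv j f + siteDeriv j g := by
  ext a
  by_cases h : j ∈ a <;> simp [siteDeriv, h]

theorem siteDeriv_subsetConv (j : Ω) (f g : Finset Ω → R) :
    siteDeriv j (subsetConv f g) = subsetConv (siteDeriv j f) g + subsetConv f (siteDeriv j g) := by
  ext a
  simp only [siteDeriv, subsetConv, Pi.add_apply, ← Finset.sum_add_distrib, Finset.mem_sdiff]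
  split_ifs with hja
  · refine Finset.sum_congr rfl fun b _ => ?_
    by_cases hjb : j ∈ b <;> simp [hja, hjb]
  · refine (Finset.sum_eq_zero fun b hb => ?_).symm
    have hjb : j ∉ b := fun hjb => hja (Finset.mem_powerset.1 hb hjb)
    simp [hja, hjb]

theorem IsCumulant.subsetConv {κ μ f g : Finset Ω → R} (hf : IsCumulant κ f)
    (hg : IsCumulant μ g) : IsCumulant (κ + μ) (subsetConv f g) := fun j => by
  rw [siteDeriv_subsetConv, hf j, hg j, siteDeriv_add, add_subsetConv, subsetConv_assoc,
    subsetConv_comm f (WeakMeasurement.subsetConv _ g), subsetConv_assoc, subsetConv_comm g f]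

theorem isCumulant_iff {κ f : Finset Ω → R} :
    IsCumulant κ f ↔ ∀ a, ∀ j ∈ a, f a = ∑ b ∈ a.powerset with j ∈ b, κ b * f (a \ b) := by
  simp only [IsCumulant, funext_iff, siteDeriv, WeakMeasurement.subsetConv, ite_mul, zero_mul,
    Finset.sum_filter]
  refine ⟨fun h a j hj => by simpa [hj] using h j a, fun h j a => ?_⟩
  split_ifs with hj
  · exact h a j hj
  · refine (Finset.sum_eq_zero fun b hb => ?_).symm
    rw [if_neg fun hjb => hj (Finset.mem_powerset.1 hb hjb)]

theorem isCumulant_prod (r : Ω → R) :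
    IsCumulant (fun a => if a.card = 1 then ∏ j ∈ a, r j else 0) (fun a => ∏ j ∈ a, r j) := by
  refine isCumulant_iff.2 fun a j hj => ?_
  rw [Finset.sum_eq_single {j}]
  · simp [← Finset.mul_prod_erase a r hj, Finset.sdiff_singleton_eq_erase]
  · intro b hb hbj
    have hcard : b.card ≠ 1 := fun h => by
      obtain ⟨i, rfl⟩ := Finset.card_eq_one.1 h
      exact hbj (by rw [Finset.mem_singleton.1 (Finset.mem_filter.1 hb).2])
    simp [hcard]
  · simp [hj]

end Semiring

theorem powerset_filter_mem_eq_insert {a : Finset Ω} {j : Ω} (hj : j ∈ a) :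
    a.powerset.filter (j ∈ ·) = insert a (a.ssubsets.filter (j ∈ ·)) := by
  rw [← Finset.insert_erase (Finset.mem_powerset_self a), Finset.filter_insert, if_pos hj,
    Finset.ssubsets]

theorem IsCumulant.eq_of_nonempty [CommRing R] [IsDomain R] {κ μ f : Finset Ω → R}
    (hκ : IsCumulant κ f) (hμ : IsCumulant μ f) (hf : f ∅ ≠ 0) {a : Finset Ω}
    (ha : a.Nonempty) : κ a = μ a := by
  induction a using Finset.strongInduction with
  | H a ih =>
    obtain ⟨j, hj⟩ := ha
    have hrec := (isCumulant_iff.1 hκ a j hj).symm.trans (isCumulant_iff.1 hμ a j hj)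
    have hproper : ∑ b ∈ a.ssubsets with j ∈ b, κ b * f (a \ b) =
        ∑ b ∈ a.ssubsets with j ∈ b, μ b * f (a \ b) := by
      refine Finset.sum_congr rfl fun b hb => ?_
      obtain ⟨hba, hjb⟩ := Finset.mem_filter.1 hb
      rw [ih b (Finset.mem_ssubsets.1 hba) ⟨j, hjb⟩]
    have hnotMem : a ∉ a.ssubsets.filter (j ∈ ·) := by simp
    rw [powerset_filter_mem_eq_insert hj, Finset.sum_insert hnotMem, Finset.sum_insert hnotMem,
      hproper, Finset.sdiff_self] at hrec
    exact mul_right_cancel₀ hf (add_right_cancel hrec)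

end SubsetConvolution

section Finpartition

variable {Ω : Type*} [DecidableEq Ω] {a b d : Finset Ω}

theorem parts_avoid_of_mem (p : Finpartition a) (hd : d ∈ p.parts) :
    (p.avoid d).parts = p.parts.erase d := by
  have hsdiff {c : Finset Ω} (hc : c ∈ p.parts) (hcd : c ≠ d) : c \ d = c :=
    Finset.sdiff_eq_self_of_disjoint (p.disjoint hc hd hcd)
  ext c
  rw [Finpartition.mem_avoid, Finset.mem_erase]
  constructor
  · rintro ⟨c, hc, hcd, rfl⟩
    have hne : c ≠ d := fun h => hcd h.le
    rw [hsdiff hc hne]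
    exact ⟨hne, hc⟩
  · rintro ⟨hne, hc⟩
    refine ⟨c, hc, fun hcd => p.ne_empty hc ?_, hsdiff hc hne⟩
    rw [← hsdiff hc hne, Finset.sdiff_eq_empty_iff_subset.2 hcd]

theorem sdiff_notMem_parts (p : Finpartition b) : a \ b ∉ p.parts := fun h => by
  obtain ⟨i, hi⟩ := p.nonempty_of_mem_parts h
  exact (Finset.mem_sdiff.1 hi).2 (p.subset h hi)

theorem sum_finpartition_ssubsets {M : Type*} [AddCommMonoid M] {j : Ω} (hj : j ∈ a)
    (F : Finset (Finset Ω) → Finset Ω → M) :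
    ∑ b ∈ a.ssubsets with j ∈ b, ∑ p : Finpartition b, F p.parts (a \ b) =
      ∑ p : Finpartition a, ∑ d ∈ p.parts with j ∉ d, F (p.parts.erase d) d := by
  rw [Finset.sum_sigma', Finset.sum_sigma']
  have hssub {x : Σ b : Finset Ω, Finpartition b}
      (hx : x ∈ (a.ssubsets.filter (j ∈ ·)).sigma fun _ => Finset.univ) : x.1 ⊂ a ∧ j ∈ x.1 := by
    simpa using hx
  refine Finset.sum_bij
    (fun x hx => ⟨x.2.extend (b := a \ x.1) (c := a)
      (by simpa [Finset.sdiff_eq_empty_iff_subset] using (hssub hx).1.2)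
      Finset.disjoint_sdiff (Finset.union_sdiff_of_subset (hssub hx).1.1), a \ x.1⟩) ?_ ?_ ?_ ?_
  · intro x hx
    simp [(hssub hx).2]
  · rintro ⟨b, p⟩ hb ⟨b', p'⟩ hb' h
    obtain ⟨hp, hd⟩ := Sigma.mk.inj h
    obtain rfl : b = b' := by
      have hbb' : a \ b = a \ b' := eq_of_heq hd
      have hba : b ⊆ a := (hssub hb).1.1
      have hba' : b' ⊆ a := (hssub hb').1.1
      rw [← Finset.sdiff_sdiff_eq_self hba, hbb', Finset.sdiff_sdiff_eq_self hba']
    refine congrArg _ (Finpartition.ext ?_)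
    simpa [Finset.erase_insert (sdiff_notMem_parts _)] using
      congrArg (fun q => q.parts.erase (a \ b)) hp
  · rintro ⟨p, d⟩ hpd
    simp only [Finset.mem_sigma, Finset.mem_univ, Finset.mem_filter, true_and] at hpd
    have hda : a \ (a \ d) = d := Finset.sdiff_sdiff_eq_self (p.subset hpd.1)
    refine ⟨⟨a \ d, p.avoid d⟩, ?_, Sigma.ext (Finpartition.ext ?_) (heq_of_eq hda)⟩
    · simpa [hj, hpd.2] using Finset.sdiff_ssubset (p.subset hpd.1) (p.nonempty_of_mem_parts hpd.1)
    · simp only [Finpartition.extend_parts, parts_avoid_of_mem p hpd.1, hda]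
      exact Finset.insert_erase hpd.1
  · intro x hx
    simp [Finset.erase_insert (sdiff_notMem_parts _)]

theorem card_parts_filter_notMem (p : Finpartition a) {j : Ω} (hj : j ∈ a) :
    (p.parts.filter (j ∉ ·)).card = p.parts.card - 1 := by
  have h : p.parts.filter (j ∉ ·) = p.parts.erase (p.part j) := by
    ext c
    simp only [Finset.mem_filter, Finset.mem_erase, and_comm (a := c ∈ p.parts)]
    refine and_congr_left fun hc => not_congr ?_
    rw [eq_comm, p.part_eq_iff_mem hc]
  rw [h, Finset.card_erase_of_mem (p.part_mem.2 hj)]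

theorem eq_indiscrete_of_card_parts_eq_one (p : Finpartition a) (ha : a ≠ ∅)
    (hp : p.parts.card = 1) : p = Finpartition.indiscrete ha := by
  obtain ⟨c, hc⟩ := Finset.card_eq_one.1 hp
  have hca : c = a := by simpa [hc] using p.sup_parts
  exact Finpartition.ext (by rw [hc, hca]; rfl)

theorem prod_prod_parts {M : Type*} [CommMonoid M] (p : Finpartition a) (u : Ω → M) :
    ∏ c ∈ p.parts, ∏ j ∈ c, u j = ∏ j ∈ a, u j := by
  have h := Finset.prod_biUnion (s := p.parts) (t := id) (f := u) p.disjoint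
  rw [p.biUnion_parts] at h
  exact h.symm

end Finpartition

section LogStar

variable {Ω : Type*} [DecidableEq Ω] {f g : Finset Ω → ℂ} {a : Finset Ω}

/-- The term of a partition with set of parts `P` in the cumulant `log* f`. -/
def logStarTerm (f : Finset Ω → ℂ) (P : Finset (Finset Ω)) : ℂ :=
  (-1) ^ (P.card - 1) * ((P.card - 1).factorial : ℂ) * ((∏ c ∈ P, f c) / f ∅ ^ P.card)

theorem logStar_of_nonempty (f : Finset Ω → ℂ) (ha : a.Nonempty) :
    logStar f a = ∑ p : Finpartition a, logStarTerm f p.parts := if_neg ha.ne_empty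

theorem logStarTerm_erase_mul (hf : f ∅ ≠ 0) {P : Finset (Finset Ω)} {d : Finset Ω} (hd : d ∈ P)
    (hP : 2 ≤ P.card) :
    (P.card - 1 : ℕ) * (logStarTerm f (P.erase d) * f d) = -(logStarTerm f P * f ∅) := by
  obtain ⟨k, hk⟩ := Nat.exists_eq_add_of_le' hP
  have hk' : (P.erase d).card = k + 1 := by rw [Finset.card_erase_of_mem hd, hk]; rfl
  rw [logStarTerm, logStarTerm, ← Finset.prod_erase_mul _ _ hd, hk, hk',
    show k + 2 - 1 = k + 1 from rfl, Nat.add_sub_cancel, Nat.factorial_succ]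
  push_cast
  field_simp
  ring

theorem sum_logStarTerm_erase_mul (hf : f ∅ ≠ 0) {j : Ω} (hj : j ∈ a) (p : Finpartition a) :
    ∑ d ∈ p.parts with j ∉ d, logStarTerm f (p.parts.erase d) * f d =
      if p.parts.card = 1 then 0 else -(logStarTerm f p.parts * f ∅) := by
  have hcard := card_parts_filter_notMem p hj
  split_ifs with h
  · rw [Finset.card_eq_zero.1 (hcard.trans (by rw [h])), Finset.sum_empty]
  · have hpos := (p.parts_nonempty (Finset.ne_empty_of_mem hj)).card_pos
    have h0 : ((p.parts.card - 1 : ℕ) : ℂ) ≠ 0 := by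
      rw [Nat.cast_ne_zero]
      omega
    have hterm : ∀ d ∈ p.parts.filter (j ∉ ·), logStarTerm f (p.parts.erase d) * f d =
        -(logStarTerm f p.parts * f ∅) / (p.parts.card - 1 : ℕ) := fun d hd => by
      rw [eq_div_iff h0, mul_comm,
        logStarTerm_erase_mul hf (Finset.mem_filter.1 hd).1 (by omega)]
    rw [Finset.sum_congr rfl hterm, Finset.sum_const, hcard, nsmul_eq_mul, mul_div_cancel₀ _ h0]

theorem isCumulant_logStar (hf : f ∅ ≠ 0) : IsCumulant (logStar f) f := by
  refine isCumulant_iff.2 fun a j hj => ?_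
  have ha : a.Nonempty := ⟨j, hj⟩
  have hproper : ∑ b ∈ a.ssubsets with j ∈ b, logStar f b * f (a \ b) =
      ∑ p : Finpartition a, if p.parts.card = 1 then 0 else -(logStarTerm f p.parts * f ∅) := by
    rw [← Finset.sum_congr rfl fun p _ => sum_logStarTerm_erase_mul hf hj p,
      ← sum_finpartition_ssubsets hj fun P d => logStarTerm f P * f d]
    refine Finset.sum_congr rfl fun b hb => ?_
    rw [logStar_of_nonempty f ⟨j, (Finset.mem_filter.1 hb).2⟩, Finset.sum_mul]
  rw [powerset_filter_mem_eq_insert hj, Finset.sum_insert (by simp), hproper, Finset.sdiff_self,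
    logStar_of_nonempty f ha, Finset.sum_mul, ← Finset.sum_add_distrib,
    Finset.sum_eq_single (Finpartition.indiscrete ha.ne_empty)]
  · simp [logStarTerm, hf]
  · intro p _ hp
    rw [if_neg fun h => hp (eq_indiscrete_of_card_parts_eq_one p ha.ne_empty h), add_neg_cancel]
  · simp

theorem IsCumulant.logStar_eq {κ : Finset Ω → ℂ} (h : IsCumulant κ f) (hf : f ∅ ≠ 0)
    (ha : a.Nonempty) : logStar f a = κ a :=
  (isCumulant_logStar hf).eq_of_nonempty h hf ha

theorem logStar_subsetConv (hf : f ∅ ≠ 0) (hg : g ∅ ≠ 0) (ha : a.Nonempty) :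
    logStar (subsetConv f g) a = logStar f a + logStar g a :=
  ((isCumulant_logStar hf).subsetConv (isCumulant_logStar hg)).logStar_eq
    (by rw [subsetConv_empty]; exact mul_ne_zero hf hg) ha

theorem logStar_prod (r : Ω → ℂ) (ha : a.Nonempty) :
    logStar (fun c => ∏ j ∈ c, r j) a = if a.card = 1 then ∏ j ∈ a, r j else 0 :=
  (isCumulant_prod r).logStar_eq (by simp) ha

theorem logStar_const_mul (f : Finset Ω → ℂ) {z : ℂ} (hz : z ≠ 0) (ha : a.Nonempty) :
    logStar (fun c => z * f c) a = logStar f a := by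
  simp only [logStar_of_nonempty _ ha, logStarTerm, Finset.prod_mul_distrib, Finset.prod_const,
    mul_pow, mul_div_mul_left _ _ (pow_ne_zero _ hz)]

theorem logStar_prod_mul (u : Ω → ℂ) (f : Finset Ω → ℂ) (ha : a.Nonempty) :
    logStar (fun c => (∏ j ∈ c, u j) * f c) a = (∏ j ∈ a, u j) * logStar f a := by
  simp only [logStar_of_nonempty _ ha, logStarTerm, Finset.prod_mul_distrib, prod_prod_parts,
    Finset.prod_empty, one_mul, Finset.mul_sum]
  exact Finset.sum_congr rfl fun p _ => by ring

theorem logStar_map (σ : ℂ →+* ℂ) (f : Finset Ω → ℂ) (ha : a.Nonempty) :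
    logStar (fun c => σ (f c)) a = σ (logStar f a) := by
  simp [logStar_of_nonempty _ ha, logStarTerm]

end LogStar

/-! ### The Dyson series -/

section Dyson

open Asymptotics MeasureTheory Topology

variable {𝔸 : Type*} [NormedRing 𝔸] [NormedAlgebra ℂ 𝔸]

/-- The evolution `exp (-i t K)` generated by `K`. -/
def evol (K : 𝔸) (t : ℝ) : 𝔸 := NormedSpace.exp ((-Complex.I * (t : ℂ)) • K)

/-- The time-ordered integrals of the Dyson series of `K`, with the operators `B 0, B 1, …` acting
in this order; the powers of `-i` are left out. -/
def dyson (K : 𝔸) : (k : ℕ) → (Fin k → 𝔸) → ℝ → 𝔸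
  | 0, _, t => evol K t
  | k + 1, B, t =>
      ∫ s in 0..t, evol K (t - s) * B (Fin.last k) * dyson K k (fun i => B i.castSucc) s

/-- The remainders of the Dyson series for `exp (-i t (K + V))`: the integrals of `dyson` with the
full evolution as the innermost factor. -/
def dysonRem (K V : 𝔸) : ℕ → ℝ → 𝔸
  | 0, t => evol (K + V) t
  | k + 1, t => ∫ s in 0..t, evol K (t - s) * V * dysonRem K V k s

theorem evol_zero (K : 𝔸) : evol K 0 = 1 := by simp [evol]

theorem commute_evol (K : 𝔸) (t : ℝ) : Commute (evol K t) K :=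
  ((Commute.refl K).smul_left _).exp_left

theorem star_evol [StarRing 𝔸] [ContinuousStar 𝔸] [StarModule ℂ 𝔸] {K : 𝔸}
    (hK : IsSelfAdjoint K) (t : ℝ) :
    star (evol K t) = NormedSpace.exp ((Complex.I * (t : ℂ)) • K) := by
  rw [evol, NormedSpace.star_exp, star_smul, hK.star_eq]
  simp

theorem norm_dysonRem_le (K V : 𝔸) {T M : ℝ} (hK : ∀ s ∈ Set.Icc 0 T, ‖evol K s‖ ≤ M)
    (hV : ∀ s ∈ Set.Icc 0 T, ‖evol (K + V) s‖ ≤ M) (m : ℕ) {t : ℝ} (ht : t ∈ Set.Icc 0 T) :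
    ‖dysonRem K V m t‖ ≤ (M * ‖V‖ * T) ^ m * M := by
  have hT : 0 ≤ T := ht.1.trans ht.2
  have hM : 0 ≤ M := (norm_nonneg _).trans (hK 0 ⟨le_rfl, hT⟩)
  induction m generalizing t with
  | zero => simpa [dysonRem] using hV t ht
  | succ m ih =>
    have hbound : ∀ s ∈ Set.uIoc 0 t, ‖evol K (t - s) * V * dysonRem K V m s‖ ≤
        M * ‖V‖ * ((M * ‖V‖ * T) ^ m * M) := by
      intro s hs
      rw [Set.uIoc_of_le ht.1] at hs
      have hs0 : t - s ∈ Set.Icc 0 T := ⟨by linarith [hs.2], by linarith [hs.1, ht.2]⟩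
      grw [norm_mul_le, norm_mul_le, hK _ hs0, ih ⟨hs.1.le, hs.2.trans ht.2⟩]
    calc ‖dysonRem K V (m + 1) t‖ ≤ M * ‖V‖ * ((M * ‖V‖ * T) ^ m * M) * |t - 0| :=
          intervalIntegral.norm_integral_le_of_norm_le_const hbound
      _ ≤ M * ‖V‖ * ((M * ‖V‖ * T) ^ m * M) * T := by
          rw [sub_zero, abs_of_nonneg ht.1]
          gcongr
          exact ht.2
      _ = (M * ‖V‖ * T) ^ (m + 1) * M := by ring

theorem dyson_smul (K : 𝔸) {k : ℕ} (z : Fin k → ℂ) (B : Fin k → 𝔸) (t : ℝ) :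
    dyson K k (fun i => z i • B i) t = (∏ i, z i) • dyson K k B t := by
  induction k generalizing t with
  | zero => simp [dyson]
  | succ k ih =>
    simp only [dyson, ih, mul_smul_comm, smul_mul_assoc, smul_smul, intervalIntegral.integral_smul,
      Fin.prod_univ_castSucc]

variable [CompleteSpace 𝔸]

theorem analyticAt_evol (t : ℝ) (K : 𝔸) : AnalyticAt ℂ (fun K : 𝔸 => evol K t) K :=
  (NormedSpace.exp_analytic (𝕂 := ℂ) _).comp (analyticAt_const.fun_smul analyticAt_id)

theorem continuous_evol_uncurry : Continuous fun p : 𝔸 × ℝ => evol p.1 p.2 := by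
  have hexp : Continuous (NormedSpace.exp : 𝔸 → 𝔸) :=
    continuous_iff_continuousAt.2 fun x => (NormedSpace.exp_analytic (𝕂 := ℂ) x).continuousAt
  exact hexp.comp (by fun_prop)

theorem continuous_evol (K : 𝔸) : Continuous (evol K) :=
  continuous_evol_uncurry.comp (.prodMk_right K)

theorem continuous_integral_evol_mul (K V : 𝔸) {f : ℝ → 𝔸} (hf : Continuous f) :
    Continuous fun t => ∫ s in 0..t, evol K (t - s) * V * f s := by
  have hK := continuous_evol K
  refine intervalIntegral.continuous_parametric_intervalIntegral_of_continuous
    (f := fun t s => evol K (t - s) * V * f s) ?_ continuous_id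
  simp only [Function.uncurry_def]
  fun_prop

theorem continuous_dyson (K : 𝔸) : ∀ (k : ℕ) (B : Fin k → 𝔸), Continuous (dyson K k B)
  | 0, _ => continuous_evol K
  | k + 1, B => continuous_integral_evol_mul K _ (continuous_dyson K k fun i => B i.castSucc)

theorem continuous_dyson_integrand (K : 𝔸) {k : ℕ} (B : Fin (k + 1) → 𝔸) (t : ℝ) :
    Continuous fun s =>
      evol K (t - s) * B (Fin.last k) * dyson K k (fun i => B i.castSucc) s := by
  have hK := continuous_evol K
  have hdyson := continuous_dyson K k fun i => B i.castSucc
  fun_prop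

theorem dyson_sum {ι : Type*} [Fintype ι] (K : 𝔸) (V : ι → 𝔸) (k : ℕ) (t : ℝ) :
    dyson K k (fun _ => ∑ j, V j) t = ∑ v : Fin k → ι, dyson K k (fun i => V (v i)) t := by
  induction k generalizing t with
  | zero => simp [dyson]
  | succ k ih =>
    simp only [dyson]
    rw [← intervalIntegral.integral_finsetSum fun v _ =>
      (continuous_dyson_integrand K (fun i => V (v i)) t).intervalIntegrable 0 t]
    refine intervalIntegral.integral_congr fun s _ => ?_
    simp only [ih, Finset.mul_sum, Finset.sum_mul, ← (Fin.snocEquiv fun _ => ι).sum_comp,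
      Fintype.sum_prod_type_right, Fin.snocEquiv_apply, Fin.snoc_castSucc, Fin.snoc_last]

theorem continuous_dysonRem (K V : 𝔸) : ∀ k : ℕ, Continuous (dysonRem K V k)
  | 0 => continuous_evol _
  | k + 1 => continuous_integral_evol_mul K V (continuous_dysonRem K V k)

theorem hasDerivAt_evol (K : 𝔸) (t : ℝ) :
    HasDerivAt (evol K) (-Complex.I • (evol K t * K)) t := by
  have hphase : HasDerivAt (fun s : ℝ => -Complex.I * (s : ℂ)) (-Complex.I) t := by
    simpa using ((hasDerivAt_id t).ofReal_comp).const_mul (-Complex.I)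
  exact (hasDerivAt_exp_smul_const (𝕂 := ℂ) K (-Complex.I * (t : ℂ))).scomp t hphase

theorem duhamel (K V : 𝔸) (t : ℝ) :
    evol (K + V) t = evol K t +
      -Complex.I • ∫ s in 0..t, evol K (t - s) * V * evol (K + V) s := by
  have hK := continuous_evol K
  have hKV := continuous_evol (K + V)
  have hderiv (s : ℝ) : HasDerivAt (fun s => evol K (t - s) * evol (K + V) s)
      (-Complex.I • (evol K (t - s) * V * evol (K + V) s)) s := by
    have hleft : HasDerivAt (fun s => evol K (t - s)) (Complex.I • (evol K (t - s) * K)) s := by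
      simpa using (hasDerivAt_evol K (t - s)).comp_const_sub t s
    convert! hleft.mul (hasDerivAt_evol (K + V) s) using 1
    rw [(commute_evol (K + V) s).eq]
    simp only [smul_mul_assoc, add_mul, mul_add, smul_add, neg_smul, mul_assoc, mul_neg,
      mul_smul_comm]
    abel
  have hftc := intervalIntegral.integral_eq_sub_of_hasDerivAt (fun s _ => hderiv s)
    (Continuous.intervalIntegrable (by fun_prop) 0 t)
  rw [intervalIntegral.integral_smul] at hftc
  rw [hftc]
  simp [evol_zero]

theorem dysonRem_eq (K V : 𝔸) (k : ℕ) (t : ℝ) :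
    dysonRem K V k t = dyson K k (fun _ => V) t + -Complex.I • dysonRem K V (k + 1) t := by
  induction k generalizing t with
  | zero => exact duhamel K V t
  | succ k ih =>
    have hK := continuous_evol K
    have hdyson := continuous_dyson K k fun _ => V
    have hrem := continuous_dysonRem K V (k + 1)
    rw [dysonRem, dyson, dysonRem, ← intervalIntegral.integral_smul,
      ← intervalIntegral.integral_add (Continuous.intervalIntegrable (by fun_prop) _ _)
        (Continuous.intervalIntegrable (by fun_prop) _ _)]
    refine intervalIntegral.integral_congr fun s _ => ?_
    rw [ih s, mul_add, mul_smul_comm]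

theorem evol_add_eq_sum (K V : 𝔸) (m : ℕ) (t : ℝ) :
    evol (K + V) t = ∑ k ∈ Finset.range m, (-Complex.I) ^ k • dyson K k (fun _ => V) t +
      (-Complex.I) ^ m • dysonRem K V m t := by
  induction m with
  | zero => simp [dysonRem]
  | succ m ih =>
    rw [ih, dysonRem_eq, Finset.sum_range_succ, smul_add, smul_smul, ← pow_succ, add_assoc]

theorem eventually_norm_evol_le (K : 𝔸) (t : ℝ) :
    ∃ M, ∀ᶠ V in 𝓝 (0 : 𝔸), ∀ s ∈ Set.Icc 0 t, ‖evol (K + V) s‖ ≤ M := by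
  obtain ⟨M, hM⟩ := isCompact_Icc.exists_bound_of_continuousOn
    (continuous_evol K).continuousOn (s := Set.Icc 0 t)
  have hcont : Continuous fun p : 𝔸 × ℝ => ‖evol (K + p.1) p.2‖ :=
    (continuous_evol_uncurry.comp (f := fun p : 𝔸 × ℝ => (K + p.1, p.2)) (by fun_prop)).norm
  refine ⟨M + 1, isCompact_Icc.eventually_forall_of_forall_eventually fun s hs => ?_⟩
  refine (hcont.continuousAt.eventually_lt continuousAt_const ?_).mono fun _ => le_of_lt
  simpa using (hM s hs).trans_lt (lt_add_one M)

theorem dysonRem_isBigO (K : 𝔸) (m : ℕ) {t : ℝ} (ht : 0 ≤ t) :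
    (fun V => dysonRem K V m t) =O[𝓝 0] fun V => ‖V‖ ^ m := by
  obtain ⟨M, hM⟩ := eventually_norm_evol_le K t
  have hK : ∀ s ∈ Set.Icc 0 t, ‖evol K s‖ ≤ M := by simpa using hM.self_of_nhds
  refine IsBigO.of_bound ((M * t) ^ m * M) (hM.mono fun V hV => ?_)
  refine (norm_dysonRem_le K V hK hV m ⟨ht, le_rfl⟩).trans_eq ?_
  rw [Real.norm_of_nonneg (by positivity)]
  ring

end Dyson

/-! ### Operators on tensor products -/

section Bipartite

variable {P : Type v} {S : Type w} [NormedAddCommGroup P] [InnerProductSpace ℂ P]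
  [NormedAddCommGroup S] [InnerProductSpace ℂ S]

theorem opTensor_tensorRight (B : P →L[ℂ] P) (A : S →L[ℂ] S) (e : S) (x : P) :
    opTensor B A (tensorRight e x) = tensorRight (A e) (B x) :=
  ContinuousLinearMap.completion_apply_coe (TensorProduct.mapL B A) (x ⊗ₜ[ℂ] e)

theorem inner_tensorRight (e e' : S) (x x' : P) :
    ⟪(tensorRight e x : Bipartite P S), tensorRight e' x'⟫_ℂ = ⟪x, x'⟫_ℂ * ⟪e, e'⟫_ℂ :=
  Completion.inner_coe (x ⊗ₜ[ℂ] e : P ⊗[ℂ] S) (x' ⊗ₜ[ℂ] e')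

theorem Bipartite.clm_ext {F : Type*} [NormedAddCommGroup F] [NormedSpace ℂ F]
    {T T' : Bipartite P S →L[ℂ] F} (h : ∀ e x, T (tensorRight e x) = T' (tensorRight e x)) :
    T = T' := by
  have hcomp : T ∘L (Completion.toComplL : P ⊗[ℂ] S →L[ℂ] Completion (P ⊗[ℂ] S)) =
      T' ∘L Completion.toComplL :=
    ContinuousLinearMap.coe_injective (TensorProduct.ext' fun x e => h e x)
  exact ContinuousLinearMap.ext (congrFun (Completion.ext T.continuous T'.continuous
    (DFunLike.congr_fun hcomp)))

theorem Bipartite.ext_inner {z z' : Bipartite P S}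
    (h : ∀ e x, ⟪z, tensorRight e x⟫_ℂ = ⟪z', tensorRight e x⟫_ℂ) : z = z' :=
  ext_inner_right ℂ (DFunLike.congr_fun
    (Bipartite.clm_ext (T := innerSL ℂ z) (T' := innerSL ℂ z') h))

variable (P S) in
/-- The map `e ↦ (x ↦ x ⊗ e)` as a bounded linear map. -/
def tensorRightL : S →L[ℂ] (P →L[ℂ] Bipartite P S) :=
  (ContinuousLinearMap.compL ℂ P (P ⊗[ℂ] S) (Bipartite P S) Completion.toComplL) ∘L
    (TensorProduct.mkL ℂ P S).flip

theorem tensorRightL_apply (e : S) : tensorRightL P S e = tensorRight e := rfl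

theorem tensorRight_add (e e' : S) :
    (tensorRight (e + e') : P →L[ℂ] Bipartite P S) = tensorRight e + tensorRight e' :=
  map_add (tensorRightL P S) e e'

theorem tensorRight_smul (c : ℂ) (e : S) :
    (tensorRight (c • e) : P →L[ℂ] Bipartite P S) = c • tensorRight e :=
  map_smul (tensorRightL P S) c e

theorem opTensor_smul_left (c : ℂ) (B : P →L[ℂ] P) (A : S →L[ℂ] S) :
    opTensor (c • B) A = c • opTensor B A :=
  Bipartite.clm_ext fun e x => by simp [opTensor_tensorRight]

theorem opTensor_add_right (B : P →L[ℂ] P) (A A' : S →L[ℂ] S) :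
    opTensor B (A + A') = opTensor B A + opTensor B A' :=
  Bipartite.clm_ext fun e x => by simp [opTensor_tensorRight, tensorRight_add]

theorem opTensor_smul_right (c : ℂ) (B : P →L[ℂ] P) (A : S →L[ℂ] S) :
    opTensor B (c • A) = c • opTensor B A :=
  Bipartite.clm_ext fun e x => by simp [opTensor_tensorRight, tensorRight_smul]

theorem opTensor_mul (B B' : P →L[ℂ] P) (A A' : S →L[ℂ] S) :
    opTensor (B * B') (A * A') = opTensor B A * opTensor B' A' :=
  Bipartite.clm_ext fun e x => by simp [opTensor_tensorRight]

theorem opTensor_one : opTensor (1 : P →L[ℂ] P) (1 : S →L[ℂ] S) = 1 :=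
  Bipartite.clm_ext fun e x => by simp [opTensor_tensorRight]

theorem norm_opTensor_le (B : P →L[ℂ] P) (A : S →L[ℂ] S) : ‖opTensor B A‖ ≤ ‖B‖ * ‖A‖ := by
  refine ContinuousLinearMap.opNorm_le_bound _ (by positivity) fun z =>
    Completion.induction_on (p := fun z : Completion (P ⊗[ℂ] S) =>
      ‖(TensorProduct.mapL B A).completion z‖ ≤ ‖B‖ * ‖A‖ * ‖z‖) z ?_ fun t => ?_
  · exact isClosed_le (TensorProduct.mapL B A).completion.continuous.norm
      (continuous_norm.const_mul _)
  · rw [ContinuousLinearMap.completion_apply_coe, Completion.norm_coe, Completion.norm_coe]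
    exact (TensorProduct.mapL B A).le_of_opNorm_le (TensorProduct.norm_mapL_le B A) t

variable (S) in
/-- The map `A ↦ B ⊗ A` as a bounded linear map. -/
def opTensorL (B : P →L[ℂ] P) : (S →L[ℂ] S) →L[ℂ] (Bipartite P S →L[ℂ] Bipartite P S) :=
  LinearMap.mkContinuous
    { toFun := opTensor B
      map_add' := opTensor_add_right B
      map_smul' := fun c A => opTensor_smul_right c B A } ‖B‖ (norm_opTensor_le B)

variable (P S) in
/-- The algebra homomorphism `A ↦ 1 ⊗ A`. -/
def opTensorHom : (S →L[ℂ] S) →ₐ[ℂ] (Bipartite P S →L[ℂ] Bipartite P S) :=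
  AlgHom.ofLinearMap (opTensorL S (1 : P →L[ℂ] P)).toLinearMap opTensor_one fun A A' =>
    opTensor_mul 1 1 A A'

theorem exp_opTensor_one [CompleteSpace S] (A : S →L[ℂ] S) :
    NormedSpace.exp (opTensor (1 : P →L[ℂ] P) A) = opTensor 1 (NormedSpace.exp A) := by
  let : NormedAlgebra ℚ (S →L[ℂ] S) := NormedAlgebra.restrictScalars ℚ ℂ _
  let : NormedAlgebra ℚ (Bipartite P S →L[ℂ] Bipartite P S) :=
    NormedAlgebra.restrictScalars ℚ ℂ _
  exact (NormedSpace.map_exp (opTensorHom P S) (opTensorL S (1 : P →L[ℂ] P)).continuous A).symm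

section Adjoints

variable [CompleteSpace P]

theorem adjoint_tensorRight_tensorRight (e e' : S) (x : P) :
    ContinuousLinearMap.adjoint (tensorRight e : P →L[ℂ] Bipartite P S) (tensorRight e' x) =
      ⟪e, e'⟫_ℂ • x := by
  refine ext_inner_left ℂ fun y => ?_
  rw [ContinuousLinearMap.adjoint_inner_right, inner_tensorRight, inner_smul_right, mul_comm]

theorem opTensor_one_ketbra (e : S) :
    opTensor (1 : P →L[ℂ] P) (ketbra e) =
      tensorRight e ∘L ContinuousLinearMap.adjoint (tensorRight e) :=
  Bipartite.clm_ext fun e' x => by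
    simp [opTensor_tensorRight, adjoint_tensorRight_tensorRight, ketbra, tensorRight_smul]

theorem star_opTensor [CompleteSpace S] (B : P →L[ℂ] P) (A : S →L[ℂ] S) :
    star (opTensor B A) = opTensor (star B) (star A) :=
  Bipartite.clm_ext fun e x => Bipartite.ext_inner fun e' x' => by
    simp only [ContinuousLinearMap.star_eq_adjoint, ContinuousLinearMap.adjoint_inner_left,
      opTensor_tensorRight, inner_tensorRight]

end Adjoints

theorem trace_rankOne [CompleteSpace S] (x y : S) :
    trace (InnerProductSpace.rankOne ℂ x y) = ⟪y, x⟫_ℂ := by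
  rw [trace, ← (chosenBasis S).tsum_inner_mul_inner y x]
  exact tsum_congr fun i => by simp

theorem partialTrace_rankOne [CompleteSpace P] [CompleteSpace S] (e : S) (x : P)
    (ζ : Bipartite P S) :
    partialTrace (InnerProductSpace.rankOne ℂ (tensorRight e x) ζ) =
      InnerProductSpace.rankOne ℂ x (ContinuousLinearMap.adjoint (tensorRight e) ζ) := by
  have hadjoint : HasSum (fun i => ContinuousLinearMap.adjoint
      (tensorRightL P S ((chosenBasis S).repr e i • chosenBasis S i)))
      (ContinuousLinearMap.adjoint (tensorRightL P S e)) :=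
    (ContinuousLinearMap.adjoint (𝕜 := ℂ) (E := P)
      (F := Bipartite P S)).toContinuousLinearEquiv.toContinuousLinearMap.hasSum
      (((chosenBasis S).hasSum_repr e).mapL (tensorRightL P S))
  refine (tsum_congr fun i => ContinuousLinearMap.ext fun y => ?_).trans
    ((hadjoint.mapL (ContinuousLinearMap.apply ℂ P ζ)).mapL
      (InnerProductSpace.rankOne ℂ x)).tsum_eq
  simp [tensorRightL_apply, adjoint_tensorRight_tensorRight, HilbertBasis.repr_apply_apply,
    smul_smul, ContinuousLinearMap.adjoint_inner_left, mul_comm]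

end Bipartite

section PiTensor

variable {Ω : Type u} [Fintype Ω] {H : Ω → Type v} [∀ j, NormedAddCommGroup (H j)]
  [∀ j, InnerProductSpace ℂ (H j)]

theorem HilbertTensor.clm_ext {F : Type*} [NormedAddCommGroup F] [NormedSpace ℂ F]
    {T T' : HilbertTensor H →L[ℂ] F} (h : ∀ x, T (productVector x) = T' (productVector x)) :
    T = T' := by
  have hcomp : T ∘L (Completion.toComplL : PreTensor H →L[ℂ] Completion (PreTensor H)) =
      T' ∘L Completion.toComplL :=
    ContinuousLinearMap.coe_injective (PiTensorProduct.ext (MultilinearMap.ext h))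
  exact ContinuousLinearMap.ext (congrFun (Completion.ext T.continuous T'.continuous
    (DFunLike.congr_fun hcomp)))

theorem HilbertTensor.ext_inner {z z' : HilbertTensor H}
    (h : ∀ x, ⟪z, productVector x⟫_ℂ = ⟪z', productVector x⟫_ℂ) : z = z' :=
  ext_inner_right ℂ (DFunLike.congr_fun
    (HilbertTensor.clm_ext (T := innerSL ℂ z) (T' := innerSL ℂ z') h))

theorem tensorOp_one : tensorOp (fun j => (1 : H j →L[ℂ] H j)) = 1 :=
  HilbertTensor.clm_ext fun x => by simp [tensorOp_productVector]

theorem star_tensorOp [∀ j, CompleteSpace (H j)] (T : ∀ j, H j →L[ℂ] H j) :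
    star (tensorOp T) = tensorOp fun j => star (T j) :=
  HilbertTensor.clm_ext fun x => HilbertTensor.ext_inner fun x' => by
    simp only [tensorOp_productVector, inner_productVector, ContinuousLinearMap.star_eq_adjoint,
      ContinuousLinearMap.adjoint_inner_left]

variable (H) in
/-- The product vector `⊗ x j` as a multilinear function of the family `x`. -/
def productVectorMultilinear : MultilinearMap ℂ H (HilbertTensor H) :=
  (Completion.toComplL (𝕜 := ℂ) (E := PreTensor H)).toLinearMap.compMultilinearMap
    (PiTensorProduct.tprod ℂ (s := H) : MultilinearMap ℂ H (PreTensor H))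

theorem productVectorMultilinear_apply (x : ∀ j, H j) :
    productVectorMultilinear H x = productVector x := rfl

theorem tensorOp_ketbra (x : ∀ j, H j) :
    tensorOp (fun j => ketbra (x j)) = ketbra (productVector x) := by
  refine HilbertTensor.clm_ext fun y => ?_
  rw [tensorOp_productVector]
  simp only [ketbra, InnerProductSpace.rankOne_apply, inner_productVector]
  exact (productVectorMultilinear H).map_smul_univ _ _

theorem tensorOp_add_smul_one [DecidableEq Ω] (T : ∀ j, H j →L[ℂ] H j) (t : Ω → ℂ)
    (c : Finset Ω) :
    tensorOp (fun j => if j ∈ c then T j + t j • 1 else 1) =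
      ∑ b ∈ c.powerset, (∏ j ∈ c \ b, t j) • tensorOp (fun j => if j ∈ b then T j else 1) := by
  refine HilbertTensor.clm_ext fun x => ?_
  have hsplit : (fun j => (if j ∈ c then T j + t j • 1 else 1 : H j →L[ℂ] H j) (x j)) =
      c.piecewise ((fun j => T j (x j)) + fun j => if j ∈ c then t j • x j else x j)
        (fun j => if j ∈ c then t j • x j else x j) := by
    ext j
    by_cases hj : j ∈ c <;> simp [hj]
  rw [tensorOp_productVector, hsplit, ← productVectorMultilinear_apply,
    MultilinearMap.map_piecewise_add]
  simp only [sum_apply, smul_apply, tensorOp_productVector]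
  refine Finset.sum_congr rfl fun b _ => ?_
  rw [← productVectorMultilinear_apply, ← MultilinearMap.map_piecewise_smul]
  congr 1
  ext j
  by_cases hj : j ∈ b
  · simp [hj]
  · by_cases hjc : j ∈ c <;> simp [hj, hjc]

end PiTensor

/-! ### The state of the pointers -/

theorem opTensor_ketbra {P : Type v} {S : Type w} [NormedAddCommGroup P] [InnerProductSpace ℂ P]
    [NormedAddCommGroup S] [InnerProductSpace ℂ S] (x : P) (e : S) :
    opTensor (ketbra x) (ketbra e) = ketbra (tensorRight e x : Bipartite P S) :=
  Bipartite.clm_ext fun e' x' => by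
    simp [opTensor_tensorRight, ketbra, inner_tensorRight, tensorRight_smul, smul_smul]

theorem isSelfAdjoint_siteOp {Ω : Type u} [Fintype Ω] [DecidableEq Ω] {H : Ω → Type v}
    [∀ j, NormedAddCommGroup (H j)] [∀ j, InnerProductSpace ℂ (H j)] [∀ j, CompleteSpace (H j)]
    (k : Ω) {T : H k →L[ℂ] H k} (hT : IsSelfAdjoint T) :
    IsSelfAdjoint (siteOp k T : HilbertTensor H →L[ℂ] HilbertTensor H) := by
  rw [IsSelfAdjoint, siteOp, star_tensorOp]
  congr 1
  ext1 j
  obtain rfl | hj := eq_or_ne j k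
  · simpa using hT.star_eq
  · simp [hj]

namespace Setup

variable {Ω : Type u} {H : Ω → Type v} {S : Type w} [∀ j, NormedAddCommGroup (H j)]
  [∀ j, InnerProductSpace ℂ (H j)] [NormedAddCommGroup S] [InnerProductSpace ℂ S]
  (W : Setup Ω H S) [Fintype Ω] [DecidableEq Ω]

/-- The initial state of pointers and system. -/
def initialVector : Bipartite (HilbertTensor H) S := tensorRight W.ψi (productVector W.φ)

/-- The unnormalized vector `⟨ψf| e^{-iτH} |φ ⊗ ψi⟩` of the pointers after the postselection; the
state `σ` is the projector onto its line. -/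
def postselected (γ : Ω → ℝ) : HilbertTensor H :=
  ContinuousLinearMap.adjoint (tensorRight W.ψf) (evol (W.hamiltonian γ) W.τ W.initialVector)

/-- The unnormalized expectation of `⊗ T j`, `j ∈ c`, after the postselection. -/
def rawMoment (T : ∀ j, H j →L[ℂ] H j) (γ : Ω → ℝ) (c : Finset Ω) : ℂ :=
  ⟪W.postselected γ, tensorOp (fun j => if j ∈ c then T j else 1) (W.postselected γ)⟫_ℂ

theorem rawMoment_empty (T : ∀ j, H j →L[ℂ] H j) (γ : Ω → ℝ) :
    W.rawMoment T γ ∅ = ⟪W.postselected γ, W.postselected γ⟫_ℂ := by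
  simp only [rawMoment, Finset.notMem_empty, if_false, tensorOp_one]
  rfl

theorem rawMoment_add_smul_one (T : ∀ j, H j →L[ℂ] H j) (t : Ω → ℂ) (γ : Ω → ℝ) :
    W.rawMoment (fun j => T j + t j • 1) γ =
      subsetConv (W.rawMoment T γ) (fun c => ∏ j ∈ c, t j) := by
  ext c
  simp only [rawMoment, tensorOp_add_smul_one, sum_apply, smul_apply, inner_sum,
    inner_smul_right, subsetConv]
  exact Finset.sum_congr rfl fun b _ => mul_comm _ _

section SelfAdjoint

variable [∀ j, CompleteSpace (H j)] [CompleteSpace S] {W}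

theorem isSelfAdjoint_hamiltonian (hHS : IsSelfAdjoint W.HS) (hA : ∀ j, IsSelfAdjoint (W.A j))
    (hs : ∀ j, IsSelfAdjoint (W.s j)) (γ : Ω → ℝ) : IsSelfAdjoint (W.hamiltonian γ) := by
  rw [IsSelfAdjoint, hamiltonian]
  simp only [star_add, star_sum, star_smul, star_opTensor, star_one, hHS.star_eq,
    (isSelfAdjoint_siteOp _ (hs _)).star_eq, (hA _).star_eq, star_inv₀, RCLike.star_def,
    Complex.conj_ofReal]

theorem unnormalized_eq_rankOne (hHS : IsSelfAdjoint W.HS) (hA : ∀ j, IsSelfAdjoint (W.A j))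
    (hs : ∀ j, IsSelfAdjoint (W.s j)) (γ : Ω → ℝ) :
    W.unnormalized γ = InnerProductSpace.rankOne ℂ (tensorRight W.ψf (W.postselected γ))
      (evol (W.hamiltonian γ) W.τ W.initialVector) := by
  rw [unnormalized, ← star_evol (isSelfAdjoint_hamiltonian hHS hA hs γ), projFinal, projInit,
    tensorOp_ketbra, opTensor_ketbra, opTensor_one_ketbra]
  refine ContinuousLinearMap.ext fun z => ?_
  simp [ketbra, postselected, initialVector, evol, ContinuousLinearMap.star_eq_adjoint,
    ContinuousLinearMap.adjoint_inner_right]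

theorem trace_unnormalized (hHS : IsSelfAdjoint W.HS) (hA : ∀ j, IsSelfAdjoint (W.A j))
    (hs : ∀ j, IsSelfAdjoint (W.s j)) (γ : Ω → ℝ) :
    trace (W.unnormalized γ) = ⟪W.postselected γ, W.postselected γ⟫_ℂ := by
  rw [unnormalized_eq_rankOne hHS hA hs, trace_rankOne, ← ContinuousLinearMap.adjoint_inner_left,
    ← postselected]

theorem partialTrace_unnormalized (hHS : IsSelfAdjoint W.HS) (hA : ∀ j, IsSelfAdjoint (W.A j))
    (hs : ∀ j, IsSelfAdjoint (W.s j)) (γ : Ω → ℝ) :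
    partialTrace (W.unnormalized γ) =
      InnerProductSpace.rankOne ℂ (W.postselected γ) (W.postselected γ) := by
  rw [unnormalized_eq_rankOne hHS hA hs, partialTrace_rankOne, ← postselected]

theorem pointerMoment_eq (hHS : IsSelfAdjoint W.HS) (hA : ∀ j, IsSelfAdjoint (W.A j))
    (hs : ∀ j, IsSelfAdjoint (W.s j)) (γ : Ω → ℝ) (c : Finset Ω) :
    W.pointerMoment γ c = (W.rawMoment W.r γ ∅)⁻¹ * W.rawMoment W.r γ c := by
  have hcomp (T : HilbertTensor H →L[ℂ] HilbertTensor H) (z : ℂ) (x : HilbertTensor H) :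
      T * z • InnerProductSpace.rankOne ℂ x x = InnerProductSpace.rankOne ℂ (z • T x) x :=
    ContinuousLinearMap.ext fun y => by simp [smul_smul]
  rw [pointerMoment, pointerState, trace_unnormalized hHS hA hs,
    partialTrace_unnormalized hHS hA hs, hcomp, trace_rankOne, inner_smul_right, rawMoment_empty,
    rawMoment]

end SelfAdjoint

theorem analyticAt_postselected (γ : Ω → ℝ) : AnalyticAt ℝ W.postselected γ := by
  have hcoord (k : Ω) : AnalyticAt ℝ (fun γ : Ω → ℝ => (γ k : ℂ)) γ :=
    (Complex.ofRealCLM ∘L ContinuousLinearMap.proj (R := ℝ) (φ := fun _ : Ω => ℝ) k).analyticAt γ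
  have hham : AnalyticAt ℝ W.hamiltonian γ :=
    analyticAt_const.fun_add
      (Finset.analyticAt_fun_sum _ fun k _ => (hcoord k).fun_smul analyticAt_const)
  exact (((ContinuousLinearMap.adjoint (tensorRight W.ψf) ∘L
    ContinuousLinearMap.apply ℂ _ W.initialVector).restrictScalars ℝ).analyticAt _).comp
    (((analyticAt_evol W.τ (W.hamiltonian γ)).restrictScalars (𝕜 := ℝ)).comp hham)

theorem analyticAt_rawMoment (T : ∀ j, H j →L[ℂ] H j) (c : Finset Ω) (γ : Ω → ℝ) :
    AnalyticAt ℝ (fun γ => W.rawMoment T γ c) γ := by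
  have hχ := W.analyticAt_postselected γ
  have hTχ := (((tensorOp fun j => if j ∈ c then T j else 1).restrictScalars ℝ).analyticAt
    (W.postselected γ)).comp hχ
  exact (hχ.contDiffAt.inner ℂ hTχ.contDiffAt (n := ⊤)).analyticAt

end Setup

/-! ### Integrals over simplices and sequential weak values -/

section Simplex

open MeasureTheory

/-- The tuples of `k` interval lengths with sum at most `T`, over which the delay times of a
sequential weak value are averaged. -/
def simplex (k : ℕ) (T : ℝ) : Set (Fin k → ℝ) := {t | (∀ i, 0 ≤ t i) ∧ ∑ i, t i ≤ T}

/-- The tuple of interval lengths extended by a last length that makes the total `T`. -/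
def completeTo {k : ℕ} (T : ℝ) (t : Fin k → ℝ) : Fin (k + 1) → ℝ :=
  Fin.snoc (α := fun _ => ℝ) t (T - ∑ i, t i)

theorem completeTo_castSucc {k : ℕ} (T : ℝ) (t : Fin k → ℝ) (i : Fin k) :
    completeTo T t i.castSucc = t i :=
  Fin.snoc_castSucc ..

theorem completeTo_last {k : ℕ} (T : ℝ) (t : Fin k → ℝ) :
    completeTo T t (Fin.last k) = T - ∑ i, t i :=
  Fin.snoc_last ..

theorem sum_completeTo {k : ℕ} (T : ℝ) (t : Fin k → ℝ) : ∑ i, completeTo T t i = T := by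
  simp [Fin.sum_univ_castSucc, completeTo_castSucc, completeTo_last]

theorem continuous_completeTo {k : ℕ} (T : ℝ) :
    Continuous (completeTo T : (Fin k → ℝ) → Fin (k + 1) → ℝ) := by
  unfold completeTo
  fun_prop

theorem isCompact_simplex (k : ℕ) (T : ℝ) : IsCompact (simplex k T) := by
  have hclosed : IsClosed (simplex k T) := by
    have : simplex k T = Set.Ici 0 ∩ {t | ∑ i, t i ≤ T} := rfl
    exact this ▸ isClosed_Ici.inter (isClosed_le (by fun_prop) (by fun_prop))
  refine (isCompact_Icc (a := 0) (b := fun _ => T)).of_isClosed_subset hclosed fun t ht => ?_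
  exact ⟨ht.1, fun i => (Finset.single_le_sum (fun i _ => ht.1 i) (Finset.mem_univ i)).trans ht.2⟩

theorem completeTo_mem_simplex {k : ℕ} {T τ : ℝ} {t : Fin k → ℝ} :
    completeTo T t ∈ simplex (k + 1) τ ↔ T ∈ Set.Icc 0 τ ∧ t ∈ simplex k T := by
  have hmem : completeTo T t ∈ simplex (k + 1) τ ↔
      ((∀ i, 0 ≤ t i) ∧ ∑ i, t i ≤ T) ∧ T ≤ τ := by
    simp [simplex, sum_completeTo, Fin.forall_fin_succ', completeTo_castSucc, completeTo_last]
  refine hmem.trans ⟨fun h => ⟨⟨?_, h.2⟩, h.1⟩, fun h => ⟨h.2, h.1.2⟩⟩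
  exact (Finset.sum_nonneg fun i _ => h.1.1 i).trans h.1.2

theorem measurePreserving_completeTo (k : ℕ) :
    MeasurePreserving (fun p : (Fin k → ℝ) × ℝ => completeTo p.2 p.1) := by
  have hshear : MeasurePreserving (fun p : (Fin k → ℝ) × ℝ => (p.1, p.2 - ∑ i, p.1 i)) :=
    (MeasurePreserving.id volume).skew_product (g := fun (t : Fin k → ℝ) T => T - ∑ i, t i)
      (by fun_prop) (.of_forall fun t => (measurePreserving_sub_right volume (∑ i, t i)).map_eq)
  convert! ((volume_preserving_piFinSuccAbove (fun _ => ℝ) (Fin.last k)).symm _).comp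
    (Measure.measurePreserving_swap.comp hshear) using 1
  ext p
  simp [completeTo, MeasurableEquiv.piFinSuccAbove, Fin.insertNthEquiv]

variable {E : Type*} [NormedAddCommGroup E] [NormedSpace ℝ E]

theorem integral_simplex_succ (k : ℕ) {τ : ℝ} (hτ : 0 ≤ τ) {G : (Fin (k + 1) → ℝ) → E}
    (hG : IntegrableOn G (simplex (k + 1) τ)) :
    ∫ t in simplex (k + 1) τ, G t = ∫ T in 0..τ, ∫ t in simplex k T, G (completeTo T t) := by
  have hmeas (k : ℕ) (T : ℝ) : MeasurableSet (simplex k T) := (isCompact_simplex k T).measurableSet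
  have hslice (T : ℝ) : ∫ t : Fin k → ℝ, (simplex (k + 1) τ).indicator G (completeTo T t) =
      (Set.Icc 0 τ).indicator (fun T => ∫ t in simplex k T, G (completeTo T t)) T := by
    classical
    by_cases hT : T ∈ Set.Icc 0 τ
    · rw [Set.indicator_of_mem hT, ← integral_indicator (hmeas k T)]
      simp only [Set.indicator_apply, completeTo_mem_simplex, hT, true_and]
    · simp [completeTo_mem_simplex, hT]
  have hF := hG.integrable_indicator (hmeas _ _)
  have hmp := measurePreserving_completeTo k
  calc ∫ t in simplex (k + 1) τ, G t
      = ∫ t, (simplex (k + 1) τ).indicator G t := (integral_indicator (hmeas _ _)).symm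
    _ = ∫ p : (Fin k → ℝ) × ℝ, (simplex (k + 1) τ).indicator G (completeTo p.2 p.1) := by
        rw [← hmp.map_eq, integral_map hmp.aemeasurable
          (hmp.map_eq ▸ hF.aestronglyMeasurable)]
    _ = ∫ T, ∫ t : Fin k → ℝ, (simplex (k + 1) τ).indicator G (completeTo T t) :=
        integral_prod_symm _ (hmp.integrable_comp_of_integrable hF)
    _ = ∫ T in 0..τ, ∫ t in simplex k T, G (completeTo T t) := by
        simp only [hslice]
        rw [integral_indicator measurableSet_Icc, integral_Icc_eq_integral_Ioc,
          intervalIntegral.integral_of_le hτ]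

end Simplex

namespace Setup

open MeasureTheory

variable {Ω : Type u} {H : Ω → Type v} {S : Type w} [∀ j, NormedAddCommGroup (H j)]
  [∀ j, InnerProductSpace ℂ (H j)] [NormedAddCommGroup S] [InnerProductSpace ℂ S]
  [CompleteSpace S] (W : Setup Ω H S)

theorem continuous_sequentialOp : ∀ (k : ℕ) (B : Fin k → S →L[ℂ] S),
    Continuous (W.sequentialOp k B)
  | 0, _ => (continuous_evol W.HS).comp (continuous_apply 0)
  | k + 1, B => by
    have hlast : Continuous fun t : Fin (k + 2) → ℝ => W.sysEvol (t (Fin.last (k + 1))) :=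
      (continuous_evol W.HS).comp (by fun_prop)
    have hinit : Continuous fun t : Fin (k + 2) → ℝ =>
        W.sequentialOp k (fun i => B i.castSucc) fun i => t i.castSucc :=
      (continuous_sequentialOp k fun i => B i.castSucc).comp (by fun_prop)
    exact (hlast.mul continuous_const).mul hinit

theorem integrableOn_sequentialOp (k : ℕ) (B : Fin k → S →L[ℂ] S) (T : ℝ) :
    IntegrableOn (fun t => W.sequentialOp k B (completeTo T t)) (simplex k T) :=
  ((W.continuous_sequentialOp k B).comp
    (continuous_completeTo T)).continuousOn.integrableOn_compact (isCompact_simplex k T)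

theorem sequentialOp_completeTo_succ (k : ℕ) (B : Fin (k + 1) → S →L[ℂ] S) (T s : ℝ)
    (t : Fin k → ℝ) :
    W.sequentialOp (k + 1) B (completeTo T (completeTo s t)) =
      evol W.HS (T - s) * B (Fin.last k) *
        W.sequentialOp k (fun i => B i.castSucc) (completeTo s t) := by
  simp only [sequentialOp, completeTo_castSucc, completeTo_last, sum_completeTo, sysEvol, evol]

theorem integral_sequentialOp (k : ℕ) (B : Fin k → S →L[ℂ] S) {T : ℝ} (hT : 0 ≤ T) :
    ∫ t in simplex k T, W.sequentialOp k B (completeTo T t) = dyson W.HS k B T := by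
  induction k generalizing T with
  | zero =>
    have hsimplex : simplex 0 T = Set.univ := Set.eq_univ_of_forall fun t => by simp [simplex, hT]
    have hlast (t : Fin 0 → ℝ) : completeTo T t 0 = T := by simpa using completeTo_last T t
    rw [hsimplex, Measure.restrict_univ, Measure.volume_pi_eq_dirac, integral_dirac]
    simp only [sequentialOp, hlast, dyson, sysEvol, evol]
  | succ k ih =>
    rw [integral_simplex_succ k hT (W.integrableOn_sequentialOp (k + 1) B T), dyson]
    refine intervalIntegral.integral_congr fun s hs => ?_
    rw [Set.uIcc_of_le hT] at hs
    simp only [sequentialOp_completeTo_succ]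
    rw [integral_const_mul_of_integrable (W.integrableOn_sequentialOp k _ s), ih _ hs.1]

theorem avgWeakValue_eq [DecidableEq Ω] (hτ : 0 ≤ W.τ) (a : Finset Ω) :
    W.avgWeakValue a = ((W.τ : ℂ) ^ a.card)⁻¹ * ∑ e : Fin a.card ≃ a,
      ⟪W.ψf, dyson W.HS a.card (fun i => W.A (e i)) W.τ W.ψi⟫_ℂ /
        ⟪W.ψf, W.sysEvol W.τ W.ψi⟫_ℂ := by
  rw [avgWeakValue]
  congr 1
  refine Finset.sum_congr rfl fun e _ => ?_
  have hamplitude := ContinuousLinearMap.integral_comp_comm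
    (innerSL ℂ W.ψf ∘L ContinuousLinearMap.apply ℂ S W.ψi)
    (W.integrableOn_sequentialOp a.card (fun i => W.A (e i)) W.τ)
  rw [W.integral_sequentialOp _ _ hτ] at hamplitude
  simp only [seqWeakValue]
  rw [integral_div]
  exact congrArg (· / _) hamplitude

end Setup

/-! ### Words and leading terms -/

section Words

variable {Ω : Type u} {k : ℕ}

/-- The multiset of the letters of a word; a word is the order in which interaction terms occur in
the Dyson series. -/
def letters (v : Fin k → Ω) : Multiset Ω := Finset.univ.val.map v

theorem card_letters (v : Fin k → Ω) : (letters v).card = k := by simp [letters]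

theorem letters_succ (v : Fin (k + 1) → Ω) :
    letters v = v (Fin.last k) ::ₘ letters fun i => v i.castSucc := by
  simp [letters, Fin.univ_castSuccEmb, Function.comp_def]

theorem letters_eq_val_iff {b : Finset Ω} {v : Fin b.card → Ω} :
    letters v = b.val ↔ Function.Injective v ∧ ∀ i, v i ∈ b := by
  constructor
  · intro h
    have hnodup : (letters v).Nodup := h ▸ b.nodup
    refine ⟨fun i i' hi => Multiset.inj_on_of_nodup_map hnodup i (Finset.mem_univ i) i'
      (Finset.mem_univ i') hi, fun i => ?_⟩
    have hmem : v i ∈ letters v := Multiset.mem_map_of_mem v (Finset.mem_univ i)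
    rwa [h] at hmem
  · rintro ⟨hinj, hmem⟩
    refine Multiset.eq_of_le_of_card_le ?_ (by rw [card_letters]; rfl)
    refine (Multiset.le_iff_subset ((Multiset.nodup_map_iff_inj_on Finset.univ.nodup).2
      fun _ _ _ _ h => hinj h)).2 fun j hj => ?_
    obtain ⟨i, -, rfl⟩ := Multiset.mem_map.1 hj
    exact hmem i

theorem sum_words_eq_sum_equiv [Fintype Ω] [DecidableEq Ω] {M : Type*} [AddCommMonoid M]
    (b : Finset Ω) (F : (Fin b.card → Ω) → M) :
    ∑ v with letters v = b.val, F v = ∑ e : Fin b.card ≃ b, F fun i => e i := by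
  refine (Finset.sum_bij (fun e _ i => (e i : Ω)) (fun e _ => ?_) (fun e _ e' _ h => ?_)
    (fun v hv => ?_) fun _ _ => rfl).symm
  · rw [Finset.mem_filter_univ, letters_eq_val_iff]
    exact ⟨Subtype.val_injective.comp e.injective, fun i => (e i).2⟩
  · exact Equiv.ext fun i => Subtype.ext (congrFun h i)
  · rw [Finset.mem_filter_univ, letters_eq_val_iff] at hv
    have hbij : Function.Bijective fun i => (⟨v i, hv.2 i⟩ : b) :=
      (Fintype.bijective_iff_injective_and_card _).2
        ⟨fun i i' h => hv.1 (congrArg Subtype.val h), by simp⟩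
    exact ⟨Equiv.ofBijective _ hbij, Finset.mem_univ _, rfl⟩

theorem add_eq_val_iff [DecidableEq Ω] {n' n : Multiset Ω} {c : Finset Ω} :
    n' + n = c.val ↔ ∃ b ⊆ c, n' = (c \ b).val ∧ n = b.val := by
  constructor
  · intro h
    have hle : n ≤ c.val := h ▸ Multiset.le_add_left n n'
    refine ⟨⟨n, Multiset.nodup_of_le hle c.nodup⟩, Finset.val_le_iff.1 hle, ?_, rfl⟩
    simp only [Finset.sdiff_val, ← h, Multiset.add_sub_cancel_right]
  · rintro ⟨b, hb, rfl, rfl⟩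
    rw [Finset.sdiff_val, Multiset.sub_add_cancel (Finset.val_le_iff.2 hb)]

theorem sum_filter_add_eq_val [DecidableEq Ω] {ι M : Type*} [Fintype ι] [AddCommMonoid M]
    (n : ι → Multiset Ω) (c : Finset Ω) (F : ι → ι → M) :
    ∑ x : ι × ι with n x.1 + n x.2 = c.val, F x.1 x.2 =
      ∑ b ∈ c.powerset, ∑ i with n i = (c \ b).val, ∑ j with n j = b.val, F i j := by
  classical
  have hsets : Finset.univ.filter (fun x : ι × ι => n x.1 + n x.2 = c.val) =
      c.powerset.biUnion fun b =>
        Finset.univ.filter (n · = (c \ b).val) ×ˢ Finset.univ.filter (n · = b.val) := by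
    ext x
    simp [add_eq_val_iff]
  rw [hsets, Finset.sum_biUnion]
  · simp only [Finset.sum_product]
  · intro b _ b' _ hne
    refine Finset.disjoint_left.2 fun x hx hx' => hne (Finset.val_injective ?_)
    simp only [Finset.mem_product, Finset.mem_filter_univ] at hx hx'
    exact hx.2.symm.trans hx'.2

end Words

section LeadingTerm

open Asymptotics Filter Topology

variable {Ω : Type u}

/-- The product of the coordinates `γ j` over a multiset of sites. -/
def monomial (γ : Ω → ℝ) (n : Multiset Ω) : ℂ := (n.map fun j => (γ j : ℂ)).prod

theorem monomial_add (γ : Ω → ℝ) (n' n : Multiset Ω) :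
    monomial γ (n' + n) = monomial γ n' * monomial γ n := by
  simp [monomial]

theorem monomial_val (γ : Ω → ℝ) (c : Finset Ω) : monomial γ c.val = ∏ j ∈ c, (γ j : ℂ) := rfl

theorem conj_monomial (γ : Ω → ℝ) (n : Multiset Ω) :
    starRingEnd ℂ (monomial γ n) = monomial γ n := by
  simp [monomial, map_multiset_prod]

theorem monomial_letters {k : ℕ} (γ : Ω → ℝ) (v : Fin k → Ω) :
    monomial γ (letters v) = ∏ i, (γ (v i) : ℂ) := by
  simp only [monomial, letters, Multiset.map_map, Finset.prod, Function.comp_def]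

theorem analyticAt_logStar [DecidableEq Ω] {E : Type*} [NormedAddCommGroup E] [NormedSpace ℝ E]
    {f : E → Finset Ω → ℂ} {x : E} (hf : ∀ c, AnalyticAt ℝ (fun x => f x c) x) (h0 : f x ∅ ≠ 0)
    {a : Finset Ω} (ha : a.Nonempty) : AnalyticAt ℝ (fun x => logStar (f x) a) x := by
  simp only [logStar_of_nonempty _ ha, logStarTerm]
  refine Finset.analyticAt_fun_sum _ fun p _ => analyticAt_const.fun_mul ?_
  exact (Finset.analyticAt_fun_prod _ fun c _ => hf c).fun_div ((hf ∅).fun_pow _) (pow_ne_zero _ h0)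

theorem isBigO_norm_pow {E : Type*} [NormedAddCommGroup E] {m n : ℕ} (h : n ≤ m) :
    (fun x : E => ‖x‖ ^ m) =O[𝓝 0] fun x => ‖x‖ ^ n := by
  refine IsBigO.of_bound 1 ?_
  filter_upwards [Metric.closedBall_mem_nhds (0 : E) zero_lt_one] with x hx
  simpa using pow_le_pow_of_le_one (norm_nonneg x) (mem_closedBall_zero_iff.1 hx) h

variable [Fintype Ω]

theorem isBigO_monomial (n : Multiset Ω) :
    (fun γ : Ω → ℝ => monomial γ n) =O[𝓝 0] fun γ => ‖γ‖ ^ n.card := by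
  have hcoord (j : Ω) : (fun γ : Ω → ℝ => (γ j : ℂ)) =O[𝓝 0] fun γ => ‖γ‖ :=
    .of_bound 1 (.of_forall fun γ => by simpa using norm_le_pi_norm γ j)
  induction n using Multiset.induction_on with
  | empty => simpa [monomial] using isBigO_refl (fun _ : Ω → ℝ => (1 : ℝ)) (𝓝 0)
  | cons j n ih => simpa [monomial, pow_succ'] using (hcoord j).mul ih

/-- Near `0` the function `f` is `z` times the product of the coordinates in `c`, up to terms of
order higher than `c.card`. -/
def HasLeadingTerm (f : (Ω → ℝ) → ℂ) (c : Finset Ω) (z : ℂ) : Prop :=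
  (fun γ => f γ - (∏ j ∈ c, (γ j : ℂ)) * z) =O[𝓝 0] fun γ => ‖γ‖ ^ (c.card + 1)

theorem hasLeadingTerm_const (z : ℂ) : HasLeadingTerm (fun _ : Ω → ℝ => z) ∅ z := by
  simpa [HasLeadingTerm] using isBigO_zero _ _

theorem hasLeadingTerm_empty_iff {f : (Ω → ℝ) → ℂ} {z : ℂ} :
    HasLeadingTerm f ∅ z ↔ (fun γ => f γ - z) =O[𝓝 0] fun γ => ‖γ‖ := by
  simp [HasLeadingTerm]

namespace HasLeadingTerm

variable {f g : (Ω → ℝ) → ℂ} {c d : Finset Ω} {z w : ℂ}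

theorem isBigO (h : HasLeadingTerm f c z) : f =O[𝓝 0] fun γ => ‖γ‖ ^ c.card := by
  have hmain : (fun γ : Ω → ℝ => (∏ j ∈ c, (γ j : ℂ)) * z) =O[𝓝 0] fun γ => ‖γ‖ ^ c.card := by
    simpa [mul_comm, monomial_val] using (isBigO_monomial c.val).const_mul_left z
  simpa using (h.trans (isBigO_norm_pow (Nat.le_succ _))).add hmain

theorem tendsto (h : HasLeadingTerm f ∅ z) : Tendsto f (𝓝 0) (𝓝 z) := by
  have hsub := (hasLeadingTerm_empty_iff.1 h).trans_tendsto tendsto_norm_zero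
  simpa using hsub.add_const z

theorem of_sub (h : HasLeadingTerm g c z)
    (hfg : (fun γ => f γ - g γ) =O[𝓝 0] fun γ => ‖γ‖ ^ (c.card + 1)) : HasLeadingTerm f c z :=
  (hfg.add h).congr_left fun γ => by ring

theorem sum {ι : Type*} {s : Finset ι} {f : ι → (Ω → ℝ) → ℂ} {z : ι → ℂ}
    (h : ∀ i ∈ s, HasLeadingTerm (f i) c (z i)) :
    HasLeadingTerm (fun γ => ∑ i ∈ s, f i γ) c (∑ i ∈ s, z i) :=
  (IsBigO.fun_sum h).congr_left fun γ => by rw [Finset.sum_sub_distrib, Finset.mul_sum]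

theorem inv (h : HasLeadingTerm f ∅ z) (hz : z ≠ 0) : HasLeadingTerm (fun γ => (f γ)⁻¹) ∅ z⁻¹ := by
  have hbdd : (fun γ => (f γ)⁻¹) =O[𝓝 0] fun _ => (1 : ℝ) := (h.tendsto.inv₀ hz).isBigO_one ℝ
  have hdiff := ((hasLeadingTerm_empty_iff.1 h).mul hbdd).const_mul_left (-z⁻¹)
  simp only [mul_one] at hdiff
  refine hasLeadingTerm_empty_iff.2 (hdiff.congr' ?_ .rfl)
  filter_upwards [h.tendsto.eventually_ne hz] with γ hγ
  field_simp
  ring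

theorem mul [DecidableEq Ω] (hf : HasLeadingTerm f c z) (hg : HasLeadingTerm g d w)
    (hcd : Disjoint c d) :
    HasLeadingTerm (fun γ => f γ * g γ) (c ∪ d) (z * w) := by
  have hleft := IsBigO.mul hf hg.isBigO
  have hright := ((isBigO_monomial c.val).const_mul_left z).mul hg
  simp only [← pow_add, add_right_comm c.card 1] at hleft
  simp only [← pow_add, ← add_assoc, Finset.card_val, monomial_val] at hright
  rw [HasLeadingTerm, Finset.card_union_of_disjoint hcd]
  refine (hleft.add hright).congr_left fun γ => ?_
  rw [Finset.prod_union hcd]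
  ring

theorem pow (h : HasLeadingTerm f ∅ z) (n : ℕ) : HasLeadingTerm (fun γ => f γ ^ n) ∅ (z ^ n) := by
  classical
  induction n with
  | zero => simpa using hasLeadingTerm_const 1
  | succ n ih => simpa [pow_succ] using ih.mul h (Finset.disjoint_empty_right _)

variable [DecidableEq Ω]

theorem prod {p : Finset (Finset Ω)} {f : Finset Ω → (Ω → ℝ) → ℂ} {z : Finset Ω → ℂ}
    (hp : (p : Set (Finset Ω)).PairwiseDisjoint id) (h : ∀ c ∈ p, HasLeadingTerm (f c) c (z c)) :
    HasLeadingTerm (fun γ => ∏ c ∈ p, f c γ) (p.biUnion id) (∏ c ∈ p, z c) := by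
  induction p using Finset.induction_on with
  | empty => simpa using hasLeadingTerm_const 1
  | insert c p hc ih =>
    have hdisj : Disjoint c (p.biUnion id) := (Finset.disjoint_biUnion_right _ _ _).2 fun d hd =>
      hp (by simp) (by simp [hd]) fun hcd => hc (hcd ▸ hd)
    simpa [Finset.prod_insert hc] using (h c (by simp)).mul
      (ih (hp.subset (by simp)) fun d hd => h d (Finset.mem_insert_of_mem hd)) hdisj

theorem logStar {f : (Ω → ℝ) → Finset Ω → ℂ} {k : Finset Ω → ℂ}
    (h : ∀ c, HasLeadingTerm (fun γ => f γ c) c (k c)) (hk : k ∅ ≠ 0) {a : Finset Ω}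
    (ha : a.Nonempty) :
    HasLeadingTerm (fun γ => WeakMeasurement.logStar (f γ) a) a (WeakMeasurement.logStar k a) := by
  simp only [logStar_of_nonempty _ ha, logStarTerm, div_eq_mul_inv]
  refine sum fun p _ => ?_
  have hparts := prod p.disjoint fun c _ => h c
  have hquot := hparts.mul (((h ∅).pow p.parts.card).inv (pow_ne_zero _ hk))
    (Finset.disjoint_empty_right _)
  have hterm := (hasLeadingTerm_const
    ((-1) ^ (p.parts.card - 1) * ((p.parts.card - 1).factorial : ℂ))).mul hquot
      (Finset.disjoint_empty_left _)
  rwa [Finset.union_empty, Finset.empty_union, p.biUnion_parts] at hterm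

end HasLeadingTerm

theorem hasLeadingTerm_sum_monomial [DecidableEq Ω] {ι : Type*} [Fintype ι] (n : ι → Multiset Ω)
    (q : ι → ℂ) (c : Finset Ω)
    (hq : ∀ i, n i ≠ c.val → (n i).card ≤ c.card → q i = 0) :
    HasLeadingTerm (fun γ => ∑ i, monomial γ (n i) * q i) c (∑ i with n i = c.val, q i) := by
  rw [Finset.sum_filter]
  refine HasLeadingTerm.sum fun i _ => ?_
  rw [HasLeadingTerm]
  split_ifs with hi
  · simpa [hi, monomial_val] using isBigO_zero _ _
  · by_cases hcard : (n i).card ≤ c.card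
    · simpa [hq i hi hcard] using isBigO_zero _ _
    · simpa [mul_comm] using ((isBigO_monomial (n i)).trans
        (isBigO_norm_pow (not_le.1 hcard))).const_mul_left (q i)

end LeadingTerm

/-! ### The expansion of the state of the pointers -/

section OpTensor

variable {P : Type v} {S : Type w} [NormedAddCommGroup P] [InnerProductSpace ℂ P]
  [NormedAddCommGroup S] [InnerProductSpace ℂ S] [CompleteSpace S]

theorem evol_opTensor_one (K : S →L[ℂ] S) (t : ℝ) :
    evol (opTensor (1 : P →L[ℂ] P) K) t = opTensor 1 (evol K t) := by
  rw [evol, ← opTensor_smul_right, exp_opTensor_one, evol]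

theorem dyson_opTensor (K : S →L[ℂ] S) {k : ℕ} (C : Fin k → P →L[ℂ] P) (B : Fin k → S →L[ℂ] S)
    (t : ℝ) :
    dyson (opTensor 1 K) k (fun i => opTensor (C i) (B i)) t =
      opTensor (List.ofFn C).reverse.prod (dyson K k B t) := by
  induction k generalizing t with
  | zero => simp [dyson, evol_opTensor_one]
  | succ k ih =>
    have hcomm := (opTensorL S (List.ofFn C).reverse.prod).intervalIntegral_comp_comm
      ((continuous_dyson_integrand K B t).intervalIntegrable (μ := MeasureTheory.volume) 0 t)
    refine Eq.trans (intervalIntegral.integral_congr fun s _ => ?_) hcomm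
    rw [ih, evol_opTensor_one, ← opTensor_mul, ← opTensor_mul, one_mul, List.ofFn_succ',
      List.concat_eq_append, List.reverse_concat, List.prod_cons]
    rfl

end OpTensor

theorem siteOp_productVector {Ω : Type u} [Fintype Ω] [DecidableEq Ω] {H : Ω → Type v}
    [∀ j, NormedAddCommGroup (H j)] [∀ j, InnerProductSpace ℂ (H j)] (k : Ω)
    (T : H k →L[ℂ] H k) (x : ∀ j, H j) :
    siteOp k T (productVector x) = productVector (Function.update x k (T (x k))) := by
  rw [siteOp, tensorOp_productVector]
  congr 1
  ext1 j
  obtain rfl | hj := eq_or_ne j k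
  · simp
  · simp [hj]

namespace Setup

open Asymptotics Topology

variable {Ω : Type u} {H : Ω → Type v} {S : Type w} [∀ j, NormedAddCommGroup (H j)]
  [∀ j, InnerProductSpace ℂ (H j)] [NormedAddCommGroup S] [InnerProductSpace ℂ S]
  (W : Setup Ω H S) [Fintype Ω] [DecidableEq Ω]

/-- The product vector of the pointers after `s j` has acted once for every occurrence of `j`
in `n`. -/
def excited (n : Multiset Ω) : HilbertTensor H := productVector fun j => (W.s j ^ n.count j) (W.φ j)

theorem prod_siteOp_apply_productVector {k : ℕ} (v : Fin k → Ω) :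
    (List.ofFn fun i => siteOp (v i) (W.s (v i))).reverse.prod (productVector W.φ) =
      W.excited (letters v) := by
  induction k with
  | zero => simp [excited, letters]
  | succ k ih =>
    rw [List.ofFn_succ', List.concat_eq_append, List.reverse_concat, List.prod_cons,
      mul_apply_eq_comp, ih, excited, siteOp_productVector, excited, letters_succ]
    congr 1
    ext1 j
    obtain rfl | hj := eq_or_ne j (v (Fin.last k))
    · simp [pow_succ']
    · simp [hj]

/-- The interaction part of the Hamiltonian. -/
def interaction (γ : Ω → ℝ) : Bipartite (HilbertTensor H) S →L[ℂ] Bipartite (HilbertTensor H) S :=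
  ∑ k, ((γ k : ℂ) * (W.τ : ℂ)⁻¹) • opTensor (siteOp k (W.s k)) (W.A k)

theorem hamiltonian_eq (γ : Ω → ℝ) :
    W.hamiltonian γ = opTensor 1 W.HS + W.interaction γ := by
  simp only [hamiltonian, interaction, opTensor_smul_left, smul_smul]

theorem interaction_isBigO : W.interaction =O[𝓝 0] fun γ => ‖γ‖ := by
  refine IsBigO.fun_sum fun k _ => ?_
  have hcoord : (fun γ : Ω → ℝ => (γ k : ℂ) * (W.τ : ℂ)⁻¹) =O[𝓝 0] fun γ => ‖γ‖ :=
    .of_bound ‖(W.τ : ℂ)⁻¹‖ (.of_forall fun γ => by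
      simpa [mul_comm] using mul_le_mul_of_nonneg_left (norm_le_pi_norm γ k) (abs_nonneg W.τ⁻¹))
  simpa using hcoord.smul (isBigO_const_one ℝ (opTensor (siteOp k (W.s k)) (W.A k)) (𝓝 0))

variable [CompleteSpace S]

theorem dyson_interaction (γ : Ω → ℝ) (k : ℕ) (t : ℝ) :
    dyson (opTensor 1 W.HS) k (fun _ => W.interaction γ) t =
      ∑ v : Fin k → Ω, (monomial γ (letters v) * (W.τ : ℂ)⁻¹ ^ k) •
        opTensor (List.ofFn fun i => siteOp (v i) (W.s (v i))).reverse.prod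
          (dyson W.HS k (fun i => W.A (v i)) t) := by
  simp only [interaction, dyson_sum, dyson_smul, dyson_opTensor, Finset.prod_mul_distrib,
    monomial_letters, Finset.prod_const, Finset.card_univ, Fintype.card_fin]

/-- The amplitude with which the interaction terms of a word contribute to the postselected
state. -/
def wordAmplitude {k : ℕ} (v : Fin k → Ω) : ℂ :=
  (-Complex.I * (W.τ : ℂ)⁻¹) ^ k * ⟪W.ψf, dyson W.HS k (fun i => W.A (v i)) W.τ W.ψi⟫_ℂ

/-- The contribution of the words of length less than `m` to `W.postselected γ`. -/
def truncated (m : ℕ) (γ : Ω → ℝ) : HilbertTensor H :=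
  ∑ x : Σ k : Fin m, Fin k → Ω,
    monomial γ (letters x.2) • W.wordAmplitude x.2 • W.excited (letters x.2)

theorem adjoint_tensorRight_dyson_interaction (γ : Ω → ℝ) (k : ℕ) :
    (-Complex.I) ^ k • ContinuousLinearMap.adjoint (tensorRight W.ψf)
      (dyson (opTensor 1 W.HS) k (fun _ => W.interaction γ) W.τ W.initialVector) =
      ∑ v : Fin k → Ω, monomial γ (letters v) • W.wordAmplitude v • W.excited (letters v) := by
  rw [dyson_interaction, sum_apply, map_sum, Finset.smul_sum]
  refine Finset.sum_congr rfl fun v _ => ?_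
  rw [smul_apply, map_smul, initialVector, opTensor_tensorRight, adjoint_tensorRight_tensorRight,
    prod_siteOp_apply_productVector, smul_smul, smul_smul, smul_smul, wordAmplitude]
  congr 1
  ring

theorem postselected_eq (m : ℕ) (γ : Ω → ℝ) :
    W.postselected γ = W.truncated m γ +
      (-Complex.I) ^ m • ContinuousLinearMap.adjoint (tensorRight W.ψf)
        (dysonRem (opTensor 1 W.HS) (W.interaction γ) m W.τ W.initialVector) := by
  rw [postselected, hamiltonian_eq, evol_add_eq_sum _ _ m, add_apply, map_add, smul_apply,
    map_smul, sum_apply, map_sum, truncated, Fintype.sum_sigma,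
    Fin.sum_univ_eq_sum_range fun k => ∑ v : Fin k → Ω,
      monomial γ (letters v) • W.wordAmplitude v • W.excited (letters v)]
  congr 1
  refine Finset.sum_congr rfl fun k _ => ?_
  rw [smul_apply, map_smul, adjoint_tensorRight_dyson_interaction]

theorem postselected_sub_truncated_isBigO (hτ : 0 ≤ W.τ) (m : ℕ) :
    (fun γ => W.postselected γ - W.truncated m γ) =O[𝓝 0] fun γ => ‖γ‖ ^ m := by
  have hV := W.interaction_isBigO
  have hrem : (fun γ => dysonRem (opTensor 1 W.HS) (W.interaction γ) m W.τ) =O[𝓝 0]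
      fun γ => ‖γ‖ ^ m :=
    ((dysonRem_isBigO _ m hτ).comp_tendsto (hV.trans_tendsto tendsto_norm_zero)).trans
      (hV.norm_left.pow m)
  have happly := ((ContinuousLinearMap.adjoint (tensorRight W.ψf) ∘L
    ContinuousLinearMap.apply ℂ _ W.initialVector).isBigO_comp _ _).trans hrem
  refine (happly.const_smul_left ((-Complex.I) ^ m)).congr_left fun γ => ?_
  rw [W.postselected_eq m γ, add_sub_cancel_left]
  rfl

end Setup

/-! ### The pointer cumulants -/

open Asymptotics Filter Topology

theorem isBigO_inner_apply_sub {α E : Type*} [NormedAddCommGroup E] [InnerProductSpace ℂ E]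
    {l : Filter α} {f g : α → E} {p : α → ℝ} (T : E →L[ℂ] E)
    (hf : f =O[l] fun _ => (1 : ℝ)) (hg : g =O[l] fun _ => (1 : ℝ))
    (hfg : (fun x => f x - g x) =O[l] p) :
    (fun x => ⟪f x, T (f x)⟫_ℂ - ⟪g x, T (g x)⟫_ℂ) =O[l] p := by
  have hinner {F G : α → E} {q r : α → ℝ} (hF : F =O[l] q) (hG : G =O[l] r) :
      (fun x => ⟪F x, G x⟫_ℂ) =O[l] fun x => q x * r x :=
    (IsBigO.of_bound 1 (.of_forall fun x => by
      simpa using norm_inner_le_norm (𝕜 := ℂ) (F x) (G x))).trans (hF.norm_left.mul hG.norm_left)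
  have hbra := hinner hfg ((T.isBigO_comp f l).trans hf)
  have hket := hinner hg ((T.isBigO_comp _ l).trans hfg)
  simp only [one_mul, mul_one] at hbra hket
  refine (hbra.add hket).congr_left fun x => ?_
  simp only [map_sub, inner_sub_left, inner_sub_right]
  ring

namespace Setup

variable {Ω : Type u} {H : Ω → Type v} {S : Type w} [∀ j, NormedAddCommGroup (H j)]
  [∀ j, InnerProductSpace ℂ (H j)] [NormedAddCommGroup S] [InnerProductSpace ℂ S]
  (W : Setup Ω H S)

/-- The pointer observable `r j - ⟨r j⟩`. -/
def centered (j : Ω) : H j →L[ℂ] H j := W.r j - W.pointerMean j (W.r j) • 1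

/-- The covariance `⟨r j s j⟩ - ⟨r j⟩ ⟨s j⟩` in the initial pointer state; it is complex, as `r j`
and `s j` need not commute. -/
def covariance (j : Ω) : ℂ :=
  W.pointerMean j (W.r j * W.s j) - W.pointerMean j (W.r j) * W.pointerMean j (W.s j)

/-- The amplitude `⟨ψf| exp (-i τ HS) |ψi⟩` of the undisturbed postselection. -/
def overlap : ℂ := ⟪W.ψf, W.sysEvol W.τ W.ψi⟫_ℂ

/-- The contribution of the ket `χ` to the lowest order of the moments `⟨χ| ∏ (r j - ⟨r j⟩) |χ⟩`
when the couplings in `b` act on it; the bra contributes the complex conjugates. -/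
def lowestOrder [DecidableEq Ω] (b : Finset Ω) : ℂ :=
  W.overlap * ((∏ j ∈ b, (-Complex.I * W.covariance j)) * W.avgWeakValue b)

variable {W}

theorem inner_centered {j : Ω} (hφ : ‖W.φ j‖ = 1) : ⟪W.φ j, W.centered j (W.φ j)⟫_ℂ = 0 := by
  simp [centered, pointerMean, inner_self_eq_norm_sq_to_K, hφ]

theorem inner_centered_s (j : Ω) :
    ⟪W.φ j, W.centered j (W.s j (W.φ j))⟫_ℂ = W.covariance j := by
  simp [centered, covariance, pointerMean]

theorem inner_s_centered {j : Ω} [CompleteSpace (H j)] (hr : IsSelfAdjoint (W.r j)) :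
    ⟪W.s j (W.φ j), W.centered j (W.φ j)⟫_ℂ = starRingEnd ℂ (W.covariance j) := by
  have hr' (x y : H j) : ⟪W.r j x, y⟫_ℂ = ⟪x, W.r j y⟫_ℂ := hr.isSymmetric x y
  have hcentered (x y : H j) : ⟪W.centered j x, y⟫_ℂ = ⟪x, W.centered j y⟫_ℂ := by
    have hmean : starRingEnd ℂ (W.pointerMean j (W.r j)) = W.pointerMean j (W.r j) := by
      rw [pointerMean, inner_conj_symm, hr']
    simp only [centered, sub_apply, smul_apply, one_apply_eq_self, inner_sub_left,
      inner_sub_right, inner_smul_left, inner_smul_right, hmean, hr']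
  rw [← inner_centered_s, inner_conj_symm, hcentered]

section Moments

variable [Fintype Ω] [DecidableEq Ω]

theorem inner_excited (T : ∀ j, H j →L[ℂ] H j) (n' n : Multiset Ω) :
    ⟪W.excited n', tensorOp T (W.excited n)⟫_ℂ =
      ∏ j, ⟪(W.s j ^ n'.count j) (W.φ j), T j ((W.s j ^ n.count j) (W.φ j))⟫_ℂ := by
  rw [excited, excited, tensorOp_productVector, inner_productVector]

theorem inner_excited_eq_zero {c : Finset Ω} (hφ : ∀ j ∈ c, ‖W.φ j‖ = 1) {n' n : Multiset Ω}
    (hne : n' + n ≠ c.val) (hcard : (n' + n).card ≤ c.card) :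
    ⟪W.excited n', tensorOp (fun j => if j ∈ c then W.centered j else 1) (W.excited n)⟫_ℂ = 0 := by
  have hmissing : ∃ j ∈ c, j ∉ n' + n := by
    by_contra! hall
    exact hne (Multiset.eq_of_le_of_card_le ((Multiset.le_iff_subset c.nodup).2 hall) hcard).symm
  obtain ⟨j, hj, hjn⟩ := hmissing
  rw [Multiset.mem_add, not_or] at hjn
  rw [inner_excited]
  refine Finset.prod_eq_zero (Finset.mem_univ j) ?_
  rw [Multiset.count_eq_zero_of_notMem hjn.1, Multiset.count_eq_zero_of_notMem hjn.2, if_pos hj]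
  exact inner_centered (hφ j hj)

theorem inner_excited_val [∀ j, CompleteSpace (H j)] (hr : ∀ j, IsSelfAdjoint (W.r j))
    (hφ : ∀ j, ‖W.φ j‖ = 1) {b c : Finset Ω} (hb : b ⊆ c) :
    ⟪W.excited (c \ b).val,
      tensorOp (fun j => if j ∈ c then W.centered j else 1) (W.excited b.val)⟫_ℂ =
      (∏ j ∈ b, W.covariance j) * ∏ j ∈ c \ b, starRingEnd ℂ (W.covariance j) := by
  have hcount (d : Finset Ω) (j : Ω) : d.val.count j = if j ∈ d then 1 else 0 :=
    Multiset.count_eq_of_nodup d.nodup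
  have hfactor (j : Ω) : ⟪(W.s j ^ (c \ b).val.count j) (W.φ j),
      (if j ∈ c then W.centered j else 1) ((W.s j ^ b.val.count j) (W.φ j))⟫_ℂ =
      (if j ∈ b then W.covariance j else 1) *
        (if j ∈ c \ b then starRingEnd ℂ (W.covariance j) else 1) := by
    rw [hcount, hcount]
    by_cases hjb : j ∈ b
    · simp [hjb, hb hjb, inner_centered_s]
    · by_cases hjc : j ∈ c
      · simp [hjb, hjc, inner_s_centered (hr j)]
      · simp [hjb, hjc, inner_self_eq_norm_sq_to_K, hφ]
  rw [inner_excited, Finset.prod_congr rfl fun j _ => hfactor j, Finset.prod_mul_distrib,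
    Finset.prod_ite_mem, Finset.prod_ite_mem, Finset.univ_inter, Finset.univ_inter]

variable [CompleteSpace S]

theorem sum_wordAmplitude (hτ : 0 ≤ W.τ) (hne : W.overlap ≠ 0) {m : ℕ} {b : Finset Ω}
    (hb : b.card < m) :
    ∑ x : Σ k : Fin m, Fin k → Ω with letters x.2 = b.val, W.wordAmplitude x.2 =
      W.overlap * ((-Complex.I) ^ b.card * W.avgWeakValue b) := by
  rw [Finset.sum_filter, Fintype.sum_sigma, Finset.sum_eq_single (⟨b.card, hb⟩ : Fin m)]
  · have hoverlap : ⟪W.ψf, W.sysEvol W.τ W.ψi⟫_ℂ = W.overlap := rfl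
    rw [← Finset.sum_filter, sum_words_eq_sum_equiv b fun v => W.wordAmplitude v,
      W.avgWeakValue_eq hτ, hoverlap]
    simp only [wordAmplitude, ← Finset.mul_sum, ← Finset.sum_div, mul_pow, inv_pow]
    field_simp
  · intro k _ hk
    refine Finset.sum_eq_zero fun v _ => if_neg fun h => hk (Fin.ext ?_)
    rw [← card_letters v, h, Finset.card_val]
  · exact fun h => absurd (Finset.mem_univ _) h

theorem inner_truncated (T : HilbertTensor H →L[ℂ] HilbertTensor H) (m : ℕ) (γ : Ω → ℝ) :
    ⟪W.truncated m γ, T (W.truncated m γ)⟫_ℂ =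
      ∑ x : (Σ k : Fin m, Fin k → Ω) × (Σ k : Fin m, Fin k → Ω),
        monomial γ (letters x.1.2 + letters x.2.2) *
          (starRingEnd ℂ (W.wordAmplitude x.1.2) * W.wordAmplitude x.2.2 *
            ⟪W.excited (letters x.1.2), T (W.excited (letters x.2.2))⟫_ℂ) := by
  simp only [truncated, sum_inner, Fintype.sum_prod_type]
  refine Finset.sum_congr rfl fun x _ => ?_
  simp only [map_sum, inner_sum]
  refine Finset.sum_congr rfl fun y _ => ?_
  simp only [map_smul, inner_smul_left, inner_smul_right, conj_monomial, monomial_add]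
  ring

theorem sum_amplitudes_eq_subsetConv [∀ j, CompleteSpace (H j)] (hτ : 0 ≤ W.τ)
    (hr : ∀ j, IsSelfAdjoint (W.r j)) (hφ : ∀ j, ‖W.φ j‖ = 1) (hne : W.overlap ≠ 0) {m : ℕ}
    {c : Finset Ω} (hc : c.card < m) :
    ∑ x : (Σ k : Fin m, Fin k → Ω) × (Σ k : Fin m, Fin k → Ω)
        with letters x.1.2 + letters x.2.2 = c.val,
      starRingEnd ℂ (W.wordAmplitude x.1.2) * W.wordAmplitude x.2.2 *
        ⟪W.excited (letters x.1.2),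
          tensorOp (fun j => if j ∈ c then W.centered j else 1) (W.excited (letters x.2.2))⟫_ℂ =
      subsetConv W.lowestOrder (fun b => starRingEnd ℂ (W.lowestOrder b)) c := by
  set T : HilbertTensor H →L[ℂ] HilbertTensor H :=
    tensorOp fun j => if j ∈ c then W.centered j else 1 with hT
  rw [sum_filter_add_eq_val (fun x : Σ k : Fin m, Fin k → Ω => letters x.2) c fun x y =>
    starRingEnd ℂ (W.wordAmplitude x.2) * W.wordAmplitude y.2 *
      ⟪W.excited (letters x.2), T (W.excited (letters y.2))⟫_ℂ]
  refine Finset.sum_congr rfl fun b hb => ?_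
  rw [Finset.mem_powerset] at hb
  have hlowest {d : Finset Ω} (hd : d ⊆ c) : W.lowestOrder d = (∏ j ∈ d, W.covariance j) *
      ∑ x : Σ k : Fin m, Fin k → Ω with letters x.2 = d.val, W.wordAmplitude x.2 := by
    rw [sum_wordAmplitude hτ hne ((Finset.card_le_card hd).trans_lt hc), lowestOrder,
      Finset.prod_mul_distrib, Finset.prod_const]
    ring
  calc
    _ = ∑ x : Σ k : Fin m, Fin k → Ω with letters x.2 = (c \ b).val,
          ∑ y : Σ k : Fin m, Fin k → Ω with letters y.2 = b.val,
            starRingEnd ℂ (W.wordAmplitude x.2) * W.wordAmplitude y.2 *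
              ((∏ j ∈ b, W.covariance j) * ∏ j ∈ c \ b, starRingEnd ℂ (W.covariance j)) := by
      refine Finset.sum_congr rfl fun x hx => Finset.sum_congr rfl fun y hy => ?_
      rw [(Finset.mem_filter.1 hx).2, (Finset.mem_filter.1 hy).2, hT,
        inner_excited_val hr hφ hb]
    _ = W.lowestOrder b * starRingEnd ℂ (W.lowestOrder (c \ b)) := by
      rw [hlowest hb, hlowest Finset.sdiff_subset, map_mul, map_prod, map_sum]
      simp only [← Finset.sum_mul, ← Finset.mul_sum]
      ring

theorem hasLeadingTerm_rawMoment_centered [∀ j, CompleteSpace (H j)] (hτ : 0 ≤ W.τ)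
    (hr : ∀ j, IsSelfAdjoint (W.r j)) (hφ : ∀ j, ‖W.φ j‖ = 1) (hne : W.overlap ≠ 0) (c : Finset Ω) :
    HasLeadingTerm (fun γ => W.rawMoment W.centered γ c) c
      (subsetConv W.lowestOrder (fun b => starRingEnd ℂ (W.lowestOrder b)) c) := by
  have hrem := W.postselected_sub_truncated_isBigO hτ (c.card + 1)
  have hstate : W.postselected =O[𝓝 0] fun _ => (1 : ℝ) :=
    (W.analyticAt_postselected 0).continuousAt.tendsto.isBigO_one ℝ
  have htrunc : W.truncated (c.card + 1) =O[𝓝 0] fun _ => (1 : ℝ) := by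
    have hone : (fun γ : Ω → ℝ => ‖γ‖ ^ (c.card + 1)) =O[𝓝 0] fun _ => (1 : ℝ) := by
      simpa using isBigO_norm_pow (E := Ω → ℝ) (Nat.zero_le (c.card + 1))
    simpa using hstate.sub (hrem.trans hone)
  refine HasLeadingTerm.of_sub ?_ (isBigO_inner_apply_sub _ hstate htrunc hrem)
  simp only [inner_truncated]
  rw [← sum_amplitudes_eq_subsetConv hτ hr hφ hne (Nat.lt_succ_self c.card)]
  refine hasLeadingTerm_sum_monomial _ _ c fun x hx hcard => ?_
  rw [inner_excited_eq_zero (fun j _ => hφ j) hx hcard, mul_zero]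

end Moments

variable [DecidableEq Ω]

theorem logStar_lowestOrder (hne : W.overlap ≠ 0) {a : Finset Ω} (ha : a.Nonempty) :
    logStar W.lowestOrder a =
      (∏ j ∈ a, (-Complex.I * W.covariance j)) * logStar W.avgWeakValue a := by
  rw [← logStar_prod_mul _ _ ha]
  exact logStar_const_mul _ hne ha

theorem rawMoment_r [Fintype Ω] (γ : Ω → ℝ) : W.rawMoment W.r γ =
    subsetConv (W.rawMoment W.centered γ) fun c => ∏ j ∈ c, W.pointerMean j (W.r j) := by
  rw [← rawMoment_add_smul_one]
  simp only [centered, sub_add_cancel]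

variable [CompleteSpace S]

theorem avgWeakValue_empty (hτ : 0 ≤ W.τ) (hne : W.overlap ≠ 0) : W.avgWeakValue ∅ = 1 := by
  have hratio (e : Fin (Finset.card (∅ : Finset Ω)) ≃ (∅ : Finset Ω)) :
      ⟪W.ψf, dyson W.HS (Finset.card (∅ : Finset Ω)) (fun i => W.A (e i)) W.τ W.ψi⟫_ℂ /
        ⟪W.ψf, W.sysEvol W.τ W.ψi⟫_ℂ = 1 := div_self hne
  rw [W.avgWeakValue_eq hτ, Finset.sum_congr rfl fun e _ => hratio e, Finset.sum_const,
    Finset.card_univ, Fintype.card_equiv (Finset.equivFin ∅).symm, Fintype.card_fin]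
  simp

theorem lowestOrder_empty (hτ : 0 ≤ W.τ) (hne : W.overlap ≠ 0) : W.lowestOrder ∅ = W.overlap := by
  simp [lowestOrder, avgWeakValue_empty hτ hne]

theorem subsetConv_lowestOrder_empty_ne_zero (hτ : 0 ≤ W.τ) (hne : W.overlap ≠ 0) :
    subsetConv W.lowestOrder (fun b => starRingEnd ℂ (W.lowestOrder b)) ∅ ≠ 0 := by
  rw [subsetConv_empty, lowestOrder_empty hτ hne]
  exact mul_ne_zero hne ((map_ne_zero _).2 hne)

theorem logStar_subsetConv_lowestOrder (hτ : 0 ≤ W.τ) (hne : W.overlap ≠ 0) {a : Finset Ω}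
    (ha : a.Nonempty) :
    logStar (subsetConv W.lowestOrder fun b => starRingEnd ℂ (W.lowestOrder b)) a =
      ((W.xi a * logStar W.avgWeakValue a).re : ℝ) := by
  obtain ⟨h0, h0'⟩ := mul_ne_zero_iff.1
    (subsetConv_empty W.lowestOrder _ ▸ subsetConv_lowestOrder_empty_ne_zero hτ hne)
  have hxi : W.xi a = (2 : ℝ) * ∏ j ∈ a, (-Complex.I * W.covariance j) := by
    rw [Finset.prod_mul_distrib, Finset.prod_const, ← mul_assoc]
    rfl
  rw [logStar_subsetConv h0 h0' ha, logStar_map _ _ ha, Complex.add_conj, hxi, mul_assoc,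
    Complex.re_ofReal_mul, logStar_lowestOrder hne ha]

variable [Fintype Ω] [∀ j, CompleteSpace (H j)]

theorem eventually_rawMoment_empty_ne_zero (hτ : 0 ≤ W.τ) (hr : ∀ j, IsSelfAdjoint (W.r j))
    (hφ : ∀ j, ‖W.φ j‖ = 1) (hne : W.overlap ≠ 0)
    (T : ∀ j, H j →L[ℂ] H j) : ∀ᶠ γ in 𝓝 0, W.rawMoment T γ ∅ ≠ 0 := by
  filter_upwards [(hasLeadingTerm_rawMoment_centered hτ hr hφ hne ∅).tendsto.eventually_ne
    (subsetConv_lowestOrder_empty_ne_zero hτ hne)] with γ hγ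
  rwa [rawMoment_empty] at hγ ⊢

theorem pointerCumulant_eventuallyEq (hτ : 0 ≤ W.τ) (hHS : IsSelfAdjoint W.HS)
    (hA : ∀ j, IsSelfAdjoint (W.A j)) (hs : ∀ j, IsSelfAdjoint (W.s j))
    (hr : ∀ j, IsSelfAdjoint (W.r j)) (hφ : ∀ j, ‖W.φ j‖ = 1) (hne : W.overlap ≠ 0)
    {a : Finset Ω} (ha : a.Nonempty) :
    W.pointerCumulant a =ᶠ[𝓝 0] fun γ => logStar (W.rawMoment W.r γ) a := by
  filter_upwards [eventually_rawMoment_empty_ne_zero hτ hr hφ hne W.r] with γ hγ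
  rw [pointerCumulant, ← logStar_const_mul (W.rawMoment W.r γ) (inv_ne_zero hγ) ha]
  exact congrArg (logStar · a) (funext fun c => pointerMoment_eq hHS hA hs γ c)

theorem pointerCumulant_empty_eventuallyEq (hτ : 0 ≤ W.τ) (hHS : IsSelfAdjoint W.HS)
    (hA : ∀ j, IsSelfAdjoint (W.A j)) (hs : ∀ j, IsSelfAdjoint (W.s j))
    (hr : ∀ j, IsSelfAdjoint (W.r j)) (hφ : ∀ j, ‖W.φ j‖ = 1) (hne : W.overlap ≠ 0) :
    W.pointerCumulant ∅ =ᶠ[𝓝 0] fun _ => 0 := by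
  filter_upwards [eventually_rawMoment_empty_ne_zero hτ hr hφ hne W.r] with γ hγ
  simp [pointerCumulant, logStar, pointerMoment_eq hHS hA hs, inv_mul_cancel₀ hγ]

theorem analyticAt_pointerCumulant (hτ : 0 ≤ W.τ) (hHS : IsSelfAdjoint W.HS)
    (hA : ∀ j, IsSelfAdjoint (W.A j)) (hs : ∀ j, IsSelfAdjoint (W.s j))
    (hr : ∀ j, IsSelfAdjoint (W.r j)) (hφ : ∀ j, ‖W.φ j‖ = 1) (hne : W.overlap ≠ 0)
    (a : Finset Ω) : AnalyticAt ℝ (W.pointerCumulant a) 0 := by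
  obtain rfl | ha := a.eq_empty_or_nonempty
  · exact analyticAt_const.congr
      (pointerCumulant_empty_eventuallyEq hτ hHS hA hs hr hφ hne).symm
  · have hanalytic := analyticAt_logStar (fun c => W.analyticAt_rawMoment W.r c 0)
      (eventually_rawMoment_empty_ne_zero hτ hr hφ hne W.r).self_of_nhds ha
    exact hanalytic.congr (pointerCumulant_eventuallyEq hτ hHS hA hs hr hφ hne ha).symm

theorem hasLeadingTerm_logStar_rawMoment_r (hτ : 0 ≤ W.τ) (hr : ∀ j, IsSelfAdjoint (W.r j))
    (hφ : ∀ j, ‖W.φ j‖ = 1) (hne : W.overlap ≠ 0) {a : Finset Ω} (ha : a.Nonempty) :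
    HasLeadingTerm (fun γ => logStar (W.rawMoment W.r γ) a -
        if a.card = 1 then ∏ j ∈ a, W.pointerMean j (W.r j) else 0) a
      ((W.xi a * logStar W.avgWeakValue a).re : ℝ) := by
  have hcentered := HasLeadingTerm.logStar (hasLeadingTerm_rawMoment_centered hτ hr hφ hne)
    (subsetConv_lowestOrder_empty_ne_zero hτ hne) ha
  rw [logStar_subsetConv_lowestOrder hτ hne ha] at hcentered
  refine IsBigO.congr' hcentered ?_ .rfl
  filter_upwards [eventually_rawMoment_empty_ne_zero hτ hr hφ hne W.centered] with γ hγ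
  rw [rawMoment_r, logStar_subsetConv hγ (by simp) ha, logStar_prod _ ha, add_sub_cancel_right]

theorem pointerCumulant_isBigO (hτ : 0 ≤ W.τ) (hHS : IsSelfAdjoint W.HS)
    (hA : ∀ j, IsSelfAdjoint (W.A j)) (hs : ∀ j, IsSelfAdjoint (W.s j))
    (hr : ∀ j, IsSelfAdjoint (W.r j)) (hφ : ∀ j, ‖W.φ j‖ = 1) (hne : W.overlap ≠ 0)
    (a : Finset Ω) :
    (fun γ : Ω → ℝ => W.pointerCumulant a γ -
      ((if a.card = 1 then ∏ j ∈ a, W.pointerMean j (W.r j) else 0) +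
        (((∏ j ∈ a, γ j) * (W.xi a * logStar W.avgWeakValue a).re : ℝ) : ℂ)))
      =O[𝓝 0] fun γ => ‖γ‖ ^ (a.card + 1) := by
  obtain rfl | ha := a.eq_empty_or_nonempty
  · refine (isBigO_zero _ _).congr' ?_ .rfl
    filter_upwards [pointerCumulant_empty_eventuallyEq hτ hHS hA hs hr hφ hne] with γ hγ
    simp [hγ, logStar, avgWeakValue_empty hτ hne]
  · refine (hasLeadingTerm_logStar_rawMoment_r hτ hr hφ hne ha).congr' ?_ .rfl
    filter_upwards [pointerCumulant_eventuallyEq hτ hHS hA hs hr hφ hne ha] with γ hγ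
    rw [hγ, Complex.ofReal_mul, Complex.ofReal_prod]
    ring

end Setup

end WeakMeasurement

end

theorem theorem4 {Ω : Type*} [Fintype Ω] [DecidableEq Ω] {H : Ω → Type*}
    [∀ j, NormedAddCommGroup (H j)] [∀ j, InnerProductSpace ℂ (H j)] [∀ j, CompleteSpace (H j)]
    {S : Type*} [NormedAddCommGroup S] [InnerProductSpace ℂ S] [CompleteSpace S]
    (W : WeakMeasurement.Setup Ω H S) (hτ : 0 < W.τ)
    (hHS : IsSelfAdjoint W.HS) (hA : ∀ j, IsSelfAdjoint (W.A j))
    (hs : ∀ j, IsSelfAdjoint (W.s j)) (hr : ∀ j, IsSelfAdjoint (W.r j))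
    (hφ : ∀ j, ‖W.φ j‖ = 1) (hψi : ‖W.ψi‖ = 1) (hψf : ‖W.ψf‖ = 1)
    (hne : inner ℂ W.ψf (W.sysEvol W.τ W.ψi) ≠ 0) (a : Finset Ω) :
    AnalyticAt ℝ (W.pointerCumulant a) 0 ∧
    (a.card ≠ 1 →
      (fun γ : Ω → ℝ => W.pointerCumulant a γ -
          (((∏ j ∈ a, γ j) * (W.xi a * WeakMeasurement.logStar W.avgWeakValue a).re : ℝ) : ℂ))
        =O[nhds 0] fun γ => ‖γ‖ ^ (a.card + 1)) ∧
    (∀ j, a = {j} →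
      (fun γ : Ω → ℝ => W.pointerCumulant a γ - (W.pointerMean j (W.r j) +
          (((∏ j ∈ a, γ j) * (W.xi a * WeakMeasurement.logStar W.avgWeakValue a).re : ℝ) : ℂ)))
        =O[nhds 0] fun γ => ‖γ‖ ^ (a.card + 1)) := by
  have hlowest := WeakMeasurement.Setup.pointerCumulant_isBigO hτ.le hHS hA hs hr hφ hne a
  refine ⟨WeakMeasurement.Setup.analyticAt_pointerCumulant hτ.le hHS hA hs hr hφ hne a, ?_, ?_⟩
  · intro hcard
    simpa only [if_neg hcard, zero_add] using hlowest
  · rintro j rfl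
    simpa only [Finset.card_singleton, if_true, Finset.prod_singleton] using hlowest
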